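/- Let $K$ be a field. Let $\mathfrak g_1$ be a Lie $2$-algebra, given by a crossed module of Lie algebras $\mu:\mathfrak g\to\mathfrak h$ over $K$ with action $\mathcal L$ of $\mathfrak h$ on $\mathfrak g$ by derivations, satisfying $\mu(\mathcal L_yx)=[y,\mu(x)]$ and $\mathcal L_{\mu(x_0)}x_1=[x_0,x_1]$. Let $\phi:W\to V$ be a linear map (a $2$-vector space), and let $\rho:\mathfrak g_1\to\mathfrak{gl}(\phi)$ be a $2$-representation, that is, a morphism of crossed modules from $\mathfrak g_1$ to the crossed module $\mathrm{Hom}(V,W)\to\{(F,f)\in\mathrm{End}(W)\oplus\mathrm{End}(V):\phi F=f\phi\}$, $A\mapsto(A\phi,\phi A)$, with bracket $[A,B]=A\phi B-B\phi A$ and action $(F,f)\cdot A=FA-Af$. Write $\rho_0^1:\mathfrak h\to\mathfrak{gl}(W)$, $\rho_0^0:\mathfrak h\to\mathfrak{gl}(V)$ and $\rho_1:\mathfrak g\to\mathrm{Hom}(V,W)$ for its components. Let $\mathfrak g_p$ be the Lie algebra of strings of $p$ composable arrows of $\mathfrak g_1$ ($\mathfrak g_0=\mathfrak h$), with elements written $\xi=(x^0,\dots,x^{p-1};y)\in\mathfrak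 g^p\oplus\mathfrak h$, where the $j$-th arrow is $(x^j,\,y+\sum_{i>j}\mu(x^i))\in\mathfrak g\oplus_{\mathcal L}\mathfrak h$ and the bracket is computed arrow by arrow; let $\hat t_p(\xi)=y+\sum_i\mu(x^i)$, and let $\partial_k:\mathfrak g_{p+1}\to\mathfrak g_p$, $0\le k\le p+1$, be the face maps: $\partial_0$ drops $x^0$; for $0<k\le p$, $\partial_k$ replaces $x^{k-1},x^k$ by $x^{k-1}+x^k$; $\partial_{p+1}$ drops $x^p$ and replaces $y$ by $y+\mu(x^p)$. For $p,q,r\ge 0$ put $$C^{p,q}_r=\textstyle\bigwedge^q\mathfrak g_p^*\otimes\bigwedge^r\mathfrak g^*\otimes W\quad(r>0),\qquad C^{p,q}_0=\textstyle\bigwedge^q\mathfrak g_p^*\otimes V,$$ understood as spaces of multilinear maps $\omega(\Xi;Z)$, $\Xi\in\mathfrak g_p^q$, $Z\in\mathfrak g^r$, alternating in $\Xi$ and in $Z$. Consider the following maps (for a tuple $\Xi$, $\Xi(a_1,\dots,a_k)$ is $\Xi$ with the entries $a_1,\dots,a_k$ removed, counting from $0$). * $\delta^{(r)}:C^{p,q}_r\to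 C^{p,q+1}_r$ is the Chevalley--Eilenberg differential of $\mathfrak g_p$ with values in the pull-back along $\hat t_p$ of the representation $\rho_0^0$ on $V$ if $r=0$, and of $\rho^{(r)}(y)\omega(x_1,\dots,x_r)=\rho_0^1(y)\omega(x_1,\dots,x_r)-\sum_k\omega(x_1,\dots,\mathcal L_yx_k,\dots,x_r)$ on $\bigwedge^r\mathfrak g^*\otimes W$ if $r>0$. * $\delta_{(1)}:C^{p,q}_r\to C^{p,q}_{r+1}$ is $\delta_{(1)}\omega(\Xi;x)=\rho_1(x)\omega(\Xi)$ if $r=0$; if $r>0$ it is, for fixed $\Xi$, the Chevalley--Eilenberg differential of $\mathfrak g$ with values in the representation $\rho_0^1\circ\mu$ on $W$. * $\partial=\sum_{k=0}^{p+1}(-1)^k\partial_k^*:C^{p,q}_r\to C^{p+1,q}_r$. * For $1\le k\le r$, the difference map $\Delta_k:C^{p,q}_r\to C^{p+1,q+k}_{r-k}$ is $$\Delta_k\omega(\Xi;Z)=\sum_{0\le a_1<\dots<a_k\le q+k-1}(-1)^{a_1+\dots+a_k}\,\omega\big(\partial_0\Xi(a_1,\dots,a_k);x^0_{a_1},\dots,x^0_{a_k},Z\big)$$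 for $\Xi=(\xi_0,\dots,\xi_{q+k-1})$, $\xi_j=(x_j^0,\dots,x_j^p;y_j)$, composed with $\phi$ when $k=r$. Put $\Delta_0=\partial$. Then the following hold. (1) The spaces $C^n_{tot}(\mathfrak g_1,\phi)=\bigoplus_{p+q+r=n}C^{p,q}_r$ with the map $\nabla:C^n_{tot}\to C^{n+1}_{tot}$ given on $C^{p,q}_r$ by $$\nabla=\delta^{(r)}+(-1)^q\delta_{(1)}+(-1)^{q+r}\partial+\sum_{k=1}^{r}(-1)^{\,r+q(k+1)+\frac{k(k-1)}2}\,\Delta_k$$ form a cochain complex: $\nabla^2=0$. (2) On $C^{p,q}_r$ the difference maps satisfy i) $\delta^{(r-k)}\Delta_k+(-1)^{k+1}\Delta_k\delta^{(r)}=\delta_{(1)}\Delta_{k+1}+(-1)^k\Delta_{k+1}\delta_{(1)}$ for all $0\le k<r$; ii) $\delta^{(0)}\Delta_r+(-1)^{r+1}\Delta_r\delta^{(r)}=(-1)^r\Delta_{r+1}\delta_{(1)}$; iii) $\sum_{i=0}^k\Delta_{k-i}\Delta_i=0$ for all $0\le k\le r$. -/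

import Mathlib

open scoped DirectSum

universe u

noncomputable section

namespace LieTwo

attribute [local instance] LieRing.ofAssociativeRing

/-! ### Crossed modules of Lie algebras (Lie 2-algebras) and their morphisms -/

/-- A crossed module of Lie algebras `mu : g → h`, with `h` acting on `g` by derivations. -/
structure CrossedModule (K : Type*) [Field K] (g h : Type*) [LieRing g] [LieAlgebra K g]
    [LieRing h] [LieAlgebra K h] where
  mu : g →ₗ⁅K⁆ h
  act : h →ₗ⁅K⁆ LieDerivation K g g
  equivariance : ∀ (y : h) (x : g), mu (act y x) = ⁅y, mu x⁆
  peiffer : ∀ x₀ x₁ : g, act (mu x₀) x₁ = ⁅x₀, x₁⁆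

/-- A (strict) morphism of crossed modules of Lie algebras. -/
structure CrossedModule.Hom {K : Type*} [Field K] {g h g' h' : Type*}
    [LieRing g] [LieAlgebra K g] [LieRing h] [LieAlgebra K h]
    [LieRing g'] [LieAlgebra K g'] [LieRing h'] [LieAlgebra K h']
    (X : CrossedModule K g h) (Y : CrossedModule K g' h') where
  top : g →ₗ⁅K⁆ g'
  bot : h →ₗ⁅K⁆ h'
  comm : ∀ x : g, bot (X.mu x) = Y.mu (top x)
  map_act : ∀ (y : h) (x : g), top (X.act y x) = Y.act (bot y) (top x)

/-! ### The linear Lie 2-algebra of a 2-vector space `φ : W → V` -/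

section Gl

variable {K : Type*} [Field K] {W V : Type*} [AddCommGroup W] [Module K W]
  [AddCommGroup V] [Module K V]

/-- The Lie algebra `Hom(V, W)` with the bracket `[A, B] = A φ B - B φ A`. -/
def GlOne (_φ : W →ₗ[K] V) : Type _ := V →ₗ[K] W

instance (φ : W →ₗ[K] V) : AddCommGroup (GlOne φ) := inferInstanceAs (AddCommGroup (V →ₗ[K] W))
instance (φ : W →ₗ[K] V) : Module K (GlOne φ) := inferInstanceAs (Module K (V →ₗ[K] W))

/-- The underlying linear map. -/
def GlOne.toLin (φ : W →ₗ[K] V) : GlOne φ ≃ₗ[K] (V →ₗ[K] W) := LinearEquiv.refl K _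

instance (φ : W →ₗ[K] V) : Bracket (GlOne φ) (GlOne φ) where
  bracket A B := (GlOne.toLin φ).symm
    (GlOne.toLin φ A ∘ₗ φ ∘ₗ GlOne.toLin φ B - GlOne.toLin φ B ∘ₗ φ ∘ₗ GlOne.toLin φ A)

theorem GlOne.toLin_lie (φ : W →ₗ[K] V) (A B : GlOne φ) (v : V) :
    GlOne.toLin φ ⁅A, B⁆ v =
      GlOne.toLin φ A (φ (GlOne.toLin φ B v)) - GlOne.toLin φ B (φ (GlOne.toLin φ A v)) := rfl

theorem GlOne.ext' {φ : W →ₗ[K] V} {A B : GlOne φ}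
    (h : ∀ v, GlOne.toLin φ A v = GlOne.toLin φ B v) : A = B :=
  (GlOne.toLin φ).injective (LinearMap.ext h)

instance (φ : W →ₗ[K] V) : LieRing (GlOne φ) where
  add_lie A B C := GlOne.ext' fun v => by
    simp only [GlOne.toLin_lie, map_add, LinearMap.add_apply]; abel
  lie_add A B C := GlOne.ext' fun v => by
    simp only [GlOne.toLin_lie, map_add, LinearMap.add_apply]; abel
  lie_self A := GlOne.ext' fun v => by simp [GlOne.toLin_lie]
  leibniz_lie A B C := GlOne.ext' fun v => by
    simp only [GlOne.toLin_lie, map_add, LinearMap.add_apply, map_sub]; abel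

instance (φ : W →ₗ[K] V) : LieAlgebra K (GlOne φ) where
  lie_smul t A B := GlOne.ext' fun v => by
    simp only [GlOne.toLin_lie, map_smul, LinearMap.smul_apply, smul_sub]

/-- The Lie algebra of pairs `(F, f)` of endomorphisms of `W` and `V` with `φ F = f φ`. -/
def GlZero (φ : W →ₗ[K] V) : LieSubalgebra K (Module.End K W × Module.End K V) where
  carrier := {a | φ ∘ₗ a.1 = a.2 ∘ₗ φ}
  add_mem' {a b} ha hb := by
    simp only [Set.mem_ofPred_eq, LinearMap.ext_iff, LinearMap.comp_apply] at *
    intro w; simp [ha, hb]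
  zero_mem' := by ext; simp
  smul_mem' t a ha := by
    simp only [Set.mem_ofPred_eq, LinearMap.ext_iff, LinearMap.comp_apply] at *
    intro w; simp [ha]
  lie_mem' {a b} ha hb := by
    simp only [Set.mem_ofPred_eq, LinearMap.ext_iff, LinearMap.comp_apply] at *
    intro w
    change φ (a.1 (b.1 w) - b.1 (a.1 w)) = a.2 (b.2 (φ w)) - b.2 (a.2 (φ w))
    rw [map_sub, ha, hb, hb, ha]

theorem GlZero.comm {φ : W →ₗ[K] V} (a : GlZero φ) (w : W) : φ (a.1.1 w) = a.1.2 (φ w) :=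
  LinearMap.congr_fun a.2 w

theorem GlZero.fst_lie {φ : W →ₗ[K] V} (a b : GlZero φ) (w : W) :
    (⁅a, b⁆ : GlZero φ).1.1 w = a.1.1 (b.1.1 w) - b.1.1 (a.1.1 w) := rfl

theorem GlZero.snd_lie {φ : W →ₗ[K] V} (a b : GlZero φ) (v : V) :
    (⁅a, b⁆ : GlZero φ).1.2 v = a.1.2 (b.1.2 v) - b.1.2 (a.1.2 v) := rfl

theorem GlZero.ext' {φ : W →ₗ[K] V} {a b : GlZero φ} (h₁ : ∀ w, a.1.1 w = b.1.1 w)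
    (h₂ : ∀ v, a.1.2 v = b.1.2 v) : a = b :=
  Subtype.ext (Prod.ext (LinearMap.ext h₁) (LinearMap.ext h₂))

/-- The map `A ↦ (A φ, φ A)`. -/
def glMu (φ : W →ₗ[K] V) : GlOne φ →ₗ⁅K⁆ GlZero φ where
  toFun A := ⟨(GlOne.toLin φ A ∘ₗ φ, φ ∘ₗ GlOne.toLin φ A), rfl⟩
  map_add' A B := GlZero.ext' (fun w => by simp) (fun v => by simp)
  map_smul' t A := GlZero.ext' (fun w => by simp) (fun v => by simp)
  map_lie' {A B} := GlZero.ext'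
    (fun w => by rw [GlZero.fst_lie]; rfl)
    (fun v => by rw [GlZero.snd_lie]; exact map_sub φ _ _)

/-- The derivation `A ↦ F A - A f` of `Hom(V, W)`. -/
def glDer (φ : W →ₗ[K] V) (a : GlZero φ) : LieDerivation K (GlOne φ) (GlOne φ) where
  toFun A := (GlOne.toLin φ).symm (a.1.1 ∘ₗ GlOne.toLin φ A - GlOne.toLin φ A ∘ₗ a.1.2)
  map_add' A B := GlOne.ext' fun v => by simp; abel
  map_smul' t A := GlOne.ext' fun v => by simp [smul_sub]
  leibniz' A B := GlOne.ext' fun v => by simp [GlOne.toLin_lie, GlZero.comm]; abel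

theorem glDer_apply (φ : W →ₗ[K] V) (a : GlZero φ) (A : GlOne φ) (v : V) :
    GlOne.toLin φ (glDer φ a A) v =
      a.1.1 (GlOne.toLin φ A v) - GlOne.toLin φ A (a.1.2 v) := rfl

/-- The linear Lie 2-algebra `gl(φ)`: the crossed module `A ↦ (A φ, φ A)` with the action
`(F, f) · A = F A - A f`. -/
def gl (φ : W →ₗ[K] V) : CrossedModule K (GlOne φ) (GlZero φ) where
  mu := glMu φ
  act :=
    { toFun := glDer φ
      map_add' := fun a b => LieDerivation.ext fun A => GlOne.ext' fun v => by
        simp [glDer_apply]; abel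
      map_smul' := fun t a => LieDerivation.ext fun A => GlOne.ext' fun v => by
        simp [glDer_apply, smul_sub]
      map_lie' := fun {a b} => LieDerivation.ext fun A => GlOne.ext' fun v => by
        rw [LieDerivation.lie_apply]
        simp only [glDer_apply, GlZero.fst_lie, GlZero.snd_lie, map_sub, LinearMap.sub_apply]
        abel }
  equivariance a A := GlZero.ext'
    (fun w => by
      rw [GlZero.fst_lie]
      change a.1.1 (GlOne.toLin φ A (φ w)) - GlOne.toLin φ A (a.1.2 (φ w)) =
        a.1.1 (GlOne.toLin φ A (φ w)) - GlOne.toLin φ A (φ (a.1.1 w))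
      rw [GlZero.comm])
    (fun v => by
      rw [GlZero.snd_lie]
      change φ (a.1.1 (GlOne.toLin φ A v) - GlOne.toLin φ A (a.1.2 v)) =
        a.1.2 (φ (GlOne.toLin φ A v)) - φ (GlOne.toLin φ A (a.1.2 v))
      rw [map_sub, GlZero.comm])
  peiffer A B := rfl

end Gl

/-! ### 2-representations -/

section Rep

variable {K : Type*} [Field K] {g h W V : Type*} [LieRing g] [LieAlgebra K g]
  [LieRing h] [LieAlgebra K h] [AddCommGroup W] [Module K W] [AddCommGroup V] [Module K V]

/-- A 2-representation of a Lie 2-algebra on the 2-vector space `φ : W → V`. -/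
abbrev TwoRep (X : CrossedModule K g h) (φ : W →ₗ[K] V) : Type _ := X.Hom (gl φ)

variable {X : CrossedModule K g h} {φ : W →ₗ[K] V} (ρ : TwoRep X φ)

/-- The component `ρ₀¹ : h → gl(W)`. -/
def TwoRep.onW : h →ₗ[K] Module.End K W where
  toFun y := (ρ.bot y).1.1
  map_add' y z := by simp
  map_smul' t y := by simp

/-- The component `ρ₀⁰ : h → gl(V)`. -/
def TwoRep.onV : h →ₗ[K] Module.End K V where
  toFun y := (ρ.bot y).1.2
  map_add' y z := by simp
  map_smul' t y := by simp

/-- The component `ρ₁ : g → Hom(V, W)`. -/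
def TwoRep.arrow : g →ₗ[K] (V →ₗ[K] W) := (GlOne.toLin φ).toLinearMap ∘ₗ (ρ.top : g →ₗ[K] GlOne φ)

end Rep

/-! ### The nerve of a Lie 2-algebra -/

section Nerve

variable {K : Type*} [Field K] {g h : Type*} [LieRing g] [LieAlgebra K g]
  [LieRing h] [LieAlgebra K h]

/-- The space `g_p` of strings of `p` composable arrows, in the coordinates
`(x⁰, …, x^{p-1}; y)` of `g^p ⊕ h`. The `j`-th arrow of the string is `(x^j, v_{j+1})` in
`g ⊕ h`, where `v_j = y + ∑_{i ≥ j} μ(x^i)`; it goes from `v_{j+1}` to `v_j`. -/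
def Nerve (_X : CrossedModule K g h) (p : ℕ) : Type _ := (Fin p → g) × h

variable (X : CrossedModule K g h)

instance (p : ℕ) : AddCommGroup (Nerve X p) := inferInstanceAs (AddCommGroup ((Fin p → g) × h))
instance (p : ℕ) : Module K (Nerve X p) := inferInstanceAs (Module K ((Fin p → g) × h))

/-- The coordinate `x^i`. -/
def Nerve.coord {p : ℕ} (i : Fin p) : Nerve X p →ₗ[K] g where
  toFun ξ := ξ.1 i
  map_add' _ _ := rfl
  map_smul' _ _ := rfl

/-- The coordinate `y`. -/
def Nerve.base {p : ℕ} : Nerve X p →ₗ[K] h where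
  toFun ξ := ξ.2
  map_add' _ _ := rfl
  map_smul' _ _ := rfl

/-- The vertex `v_j = y + ∑_{i ≥ j} μ(x^i)` of a string; `v_0` is its final target. -/
def Nerve.vertex {p : ℕ} (j : ℕ) : Nerve X p →ₗ[K] h :=
  Nerve.base X + ∑ i ∈ Finset.univ.filter (fun i : Fin p => j ≤ (i : ℕ)),
    (X.mu : g →ₗ[K] h) ∘ₗ Nerve.coord X i

theorem Nerve.vertex_apply {p : ℕ} (j : ℕ) (ξ : Nerve X p) :
    Nerve.vertex X j ξ = Nerve.base X ξ +
      ∑ i ∈ Finset.univ.filter (fun i : Fin p => j ≤ (i : ℕ)), X.mu (Nerve.coord X i ξ) := by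
  rw [Nerve.vertex, LinearMap.add_apply, LinearMap.sum_apply]; rfl

/-- The `i`-th arrow of a string. -/
def Nerve.arrow {p : ℕ} (i : Fin p) (ξ : Nerve X p) : LieAlgebra.SemiDirectSum g h X.act :=
  ⟨Nerve.coord X i ξ, Nerve.vertex X ((i : ℕ) + 1) ξ⟩

/-- The bracket of `g_p` is computed arrow by arrow in the semi-direct sum `g ⊕ h`. -/
instance (p : ℕ) : Bracket (Nerve X p) (Nerve X p) where
  bracket ξ η :=
    ((fun i => (⁅Nerve.arrow X i ξ, Nerve.arrow X i η⁆).left, ⁅Nerve.base X ξ, Nerve.base X η⁆) :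
      (Fin p → g) × h)

theorem Nerve.ext' {p : ℕ} {ξ η : Nerve X p} (h₁ : ∀ i, Nerve.coord X i ξ = Nerve.coord X i η)
    (h₂ : Nerve.base X ξ = Nerve.base X η) : ξ = η :=
  Prod.ext (funext h₁) h₂

theorem Nerve.base_lie {p : ℕ} (ξ η : Nerve X p) :
    Nerve.base X ⁅ξ, η⁆ = ⁅Nerve.base X ξ, Nerve.base X η⁆ := rfl

theorem Nerve.coord_lie {p : ℕ} (i : Fin p) (ξ η : Nerve X p) :
    Nerve.coord X i ⁅ξ, η⁆ = ⁅Nerve.coord X i ξ, Nerve.coord X i η⁆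
      + X.act (Nerve.vertex X ((i : ℕ) + 1) ξ) (Nerve.coord X i η)
      - X.act (Nerve.vertex X ((i : ℕ) + 1) η) (Nerve.coord X i ξ) := rfl

theorem Nerve.vertex_of_le {p : ℕ} {j : ℕ} (hj : p ≤ j) :
    (Nerve.vertex X j : Nerve X p →ₗ[K] h) = Nerve.base X := by
  have : (Finset.univ.filter fun i : Fin p => j ≤ (i : ℕ)) = ∅ := by
    ext i; have := i.2; simp; omega
  simp [Nerve.vertex, this]

theorem Nerve.vertex_step {p : ℕ} (i : Fin p) :
    (Nerve.vertex X (i : ℕ) : Nerve X p →ₗ[K] h) =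
      Nerve.vertex X ((i : ℕ) + 1) + (X.mu : g →ₗ[K] h) ∘ₗ Nerve.coord X i := by
  have : (Finset.univ.filter fun k : Fin p => (i : ℕ) ≤ (k : ℕ)) =
      insert i (Finset.univ.filter fun k : Fin p => (i : ℕ) + 1 ≤ (k : ℕ)) := by
    ext k; simp [Fin.ext_iff]; omega
  rw [Nerve.vertex, Nerve.vertex, this, Finset.sum_insert (by simp)]
  abel

theorem Nerve.vertex_lie {p : ℕ} (j : ℕ) (ξ η : Nerve X p) :
    Nerve.vertex X j ⁅ξ, η⁆ = ⁅Nerve.vertex X j ξ, Nerve.vertex X j η⁆ := by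
  by_cases hj : p ≤ j
  · simp only [Nerve.vertex_of_le X hj, Nerve.base_lie]
  · push Not at hj
    have ih := Nerve.vertex_lie (j + 1) ξ η
    have hs := Nerve.vertex_step X (⟨j, hj⟩ : Fin p)
    simp only at hs
    simp only [hs, LinearMap.add_apply, LinearMap.comp_apply, ih, Nerve.coord_lie, map_add, map_sub,
      LieHom.coe_toLinearMap, LieHom.map_lie, X.equivariance, lie_add, add_lie]
    rw [← lie_skew (X.mu _) (Nerve.vertex X (j + 1) η)]
    abel
termination_by p - j

/-- The bracket of `g_p` is the one inherited from the product of the Lie algebras of arrows. -/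
theorem Nerve.arrow_lie {p : ℕ} (i : Fin p) (ξ η : Nerve X p) :
    Nerve.arrow X i ⁅ξ, η⁆ = ⁅Nerve.arrow X i ξ, Nerve.arrow X i η⁆ :=
  LieAlgebra.SemiDirectSum.ext rfl (Nerve.vertex_lie X _ ξ η)

theorem Nerve.arrow_add {p : ℕ} (i : Fin p) (ξ η : Nerve X p) :
    Nerve.arrow X i (ξ + η) = Nerve.arrow X i ξ + Nerve.arrow X i η :=
  LieAlgebra.SemiDirectSum.ext (map_add _ _ _) (map_add _ _ _)

theorem Nerve.arrow_smul {p : ℕ} (i : Fin p) (t : K) (ξ : Nerve X p) :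
    Nerve.arrow X i (t • ξ) = t • Nerve.arrow X i ξ :=
  LieAlgebra.SemiDirectSum.ext (map_smul _ _ _) (map_smul _ _ _)

theorem Nerve.ext_arrow {p : ℕ} {ξ η : Nerve X p} (h₁ : ∀ i, Nerve.arrow X i ξ = Nerve.arrow X i η)
    (h₂ : Nerve.base X ξ = Nerve.base X η) : ξ = η :=
  Nerve.ext' X (fun i => congrArg LieAlgebra.SemiDirectSum.left (h₁ i)) h₂

instance (p : ℕ) : LieRing (Nerve X p) where
  add_lie ξ η ζ := Nerve.ext_arrow X
    (fun i => by simp only [Nerve.arrow_lie, Nerve.arrow_add, add_lie])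
    (by simp only [Nerve.base_lie, map_add, add_lie])
  lie_add ξ η ζ := Nerve.ext_arrow X
    (fun i => by simp only [Nerve.arrow_lie, Nerve.arrow_add, lie_add])
    (by simp only [Nerve.base_lie, map_add, lie_add])
  lie_self ξ := Nerve.ext' X
    (fun i => by simp [Nerve.coord_lie])
    (by simp [Nerve.base_lie])
  leibniz_lie ξ η ζ := Nerve.ext_arrow X
    (fun i => by simp only [Nerve.arrow_lie, Nerve.arrow_add]; exact leibniz_lie _ _ _)
    (by simp only [Nerve.base_lie, map_add]; exact leibniz_lie _ _ _)

instance (p : ℕ) : LieAlgebra K (Nerve X p) where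
  lie_smul t ξ η := Nerve.ext_arrow X
    (fun i => by simp only [Nerve.arrow_lie, Nerve.arrow_smul]; exact lie_smul _ _ _)
    (by simp only [Nerve.base_lie, map_smul, lie_smul])

/-- The face maps `∂_k : g_{p+1} → g_p`:
`∂_0` drops `x⁰`; `∂_k` replaces `x^{k-1}, x^k` by `x^{k-1} + x^k` for `0 < k ≤ p`; and
`∂_{p+1}` drops `x^p` and replaces `y` by `y + μ(x^p)`. -/
def Nerve.faceFun {p : ℕ} (k : Fin (p + 2)) (ξ : Nerve X (p + 1)) : Nerve X p :=
  ((fun i =>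
      if (i : ℕ) + 1 < k then Nerve.coord X i.castSucc ξ
      else if (i : ℕ) + 1 = k then Nerve.coord X i.castSucc ξ + Nerve.coord X i.succ ξ
      else Nerve.coord X i.succ ξ,
    if (k : ℕ) = p + 1 then Nerve.base X ξ + X.mu (Nerve.coord X (Fin.last p) ξ)
    else Nerve.base X ξ) : (Fin p → g) × h)

theorem Nerve.coord_faceFun {p : ℕ} (k : Fin (p + 2)) (i : Fin p) (ξ : Nerve X (p + 1)) :
    Nerve.coord X i (Nerve.faceFun X k ξ) =
      if (i : ℕ) + 1 < k then Nerve.coord X i.castSucc ξ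
      else if (i : ℕ) + 1 = k then Nerve.coord X i.castSucc ξ + Nerve.coord X i.succ ξ
      else Nerve.coord X i.succ ξ := rfl

theorem Nerve.base_faceFun {p : ℕ} (k : Fin (p + 2)) (ξ : Nerve X (p + 1)) :
    Nerve.base X (Nerve.faceFun X k ξ) =
      if (k : ℕ) = p + 1 then Nerve.base X ξ + X.mu (Nerve.coord X (Fin.last p) ξ)
      else Nerve.base X ξ := rfl

/-- The face maps as linear maps. -/
def Nerve.face {p : ℕ} (k : Fin (p + 2)) : Nerve X (p + 1) →ₗ[K] Nerve X p where
  toFun := Nerve.faceFun X k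
  map_add' ξ η := Nerve.ext' X
    (fun i => by
      rw [map_add, Nerve.coord_faceFun, Nerve.coord_faceFun, Nerve.coord_faceFun]
      split_ifs <;> simp only [map_add]
      abel)
    (by
      rw [map_add, Nerve.base_faceFun, Nerve.base_faceFun, Nerve.base_faceFun]
      split_ifs <;> simp only [map_add]
      abel)
  map_smul' t ξ := Nerve.ext' X
    (fun i => by
      rw [map_smul, Nerve.coord_faceFun, Nerve.coord_faceFun]
      split_ifs <;> simp only [map_smul, smul_add, RingHom.id_apply])
    (by
      rw [map_smul, Nerve.base_faceFun, Nerve.base_faceFun]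
      split_ifs <;> simp only [map_smul, smul_add, RingHom.id_apply])

theorem Nerve.coord_face {p : ℕ} (k : Fin (p + 2)) (i : Fin p) (ξ : Nerve X (p + 1)) :
    Nerve.coord X i (Nerve.face X k ξ) =
      if (i : ℕ) + 1 < k then Nerve.coord X i.castSucc ξ
      else if (i : ℕ) + 1 = k then Nerve.coord X i.castSucc ξ + Nerve.coord X i.succ ξ
      else Nerve.coord X i.succ ξ := rfl

theorem Nerve.base_face {p : ℕ} (k : Fin (p + 2)) (ξ : Nerve X (p + 1)) :
    Nerve.base X (Nerve.face X k ξ) =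
      if (k : ℕ) = p + 1 then Nerve.base X ξ + X.mu (Nerve.coord X (Fin.last p) ξ)
      else Nerve.base X ξ := rfl

end Nerve

/-! ### Alternating maps: auxiliary constructions -/

section Alternating

variable {K : Type*} [Field K] {L M N : Type*} [AddCommGroup L] [Module K L]
  [AddCommGroup M] [Module K M] [AddCommGroup N] [Module K N]

/-- A multilinear map that vanishes when two neighbouring arguments agree is alternating. -/
theorem eq_zero_of_adjacent {n : ℕ} (f : MultilinearMap K (fun _ : Fin n => L) N)
    (hf : ∀ (v : Fin n → L) (i j : Fin n), (j : ℕ) = i + 1 → v i = v j → f v = 0)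
    (v : Fin n → L) (i j : Fin n) (hv : v i = v j) (hij : i ≠ j) : f v = 0 := by
  have key : ∀ (d : ℕ) (v : Fin n → L) (i j : Fin n), (j : ℕ) = i + (d + 1) → v i = v j →
      f v = 0 := by
    intro d
    induction d with
    | zero => exact fun v i j h => hf v i j h
    | succ d ih =>
      intro v i j h hv
      have hj := j.2
      let m : Fin n := ⟨(j : ℕ) - 1, by omega⟩
      have hm : (j : ℕ) = m + 1 := by simp only [m]; omega
      have hmj : m ≠ j := by intro h'; rw [h'] at hm; omega
      have him : i ≠ m := by intro h'; rw [← h'] at hm; omega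
      have hij' : i ≠ j := by intro h'; rw [← h'] at h; omega
      have e : ∀ x y : L, f (Function.update (Function.update v m x) j y) =
          - f (Function.update (Function.update v m y) j x) := by
        intro x y
        have z : ∀ w : L, f (Function.update (Function.update v m w) j w) = 0 := fun w =>
          hf _ m j hm (by simp [hmj])
        have addR : ∀ w x y : L, f (Function.update (Function.update v m w) j (x + y)) =
            f (Function.update (Function.update v m w) j x) +
            f (Function.update (Function.update v m w) j y) := fun w x y => f.map_update_add _ _ _ _
        have addL : ∀ w x y : L, f (Function.update (Function.update v m (x + y)) j w) =
            f (Function.update (Function.update v m x) j w) +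
            f (Function.update (Function.update v m y) j w) := fun w x y => by
          simp only [Function.update_comm hmj]
          exact f.map_update_add _ _ _ _
        have h1 := z (x + y)
        rw [addR, addL, addL, z, z, zero_add, add_zero] at h1
        exact eq_neg_of_add_eq_zero_right h1
      have h2 := e (v m) (v j)
      rw [Function.update_eq_self, Function.update_eq_self] at h2
      rw [h2, ih (Function.update (Function.update v m (v j)) j (v m)) i m (by omega)
        (by simp [hmj, him, hij', hv]), neg_zero]
  rcases lt_or_gt_of_ne hij with h | h
  · exact key ((j : ℕ) - i - 1) v i j (by have : (i : ℕ) < j := h; omega) hv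
  · exact key ((i : ℕ) - j - 1) v j i (by have : (j : ℕ) < i := h; omega) hv.symm

/-- The `k`-element subsets `a = {a₁ < ⋯ < a_k}` of `{0, …, q + k - 1}`. -/
abbrev Sub (q k : ℕ) : Type := {a : Finset (Fin (q + k)) // a.card = k}

theorem Sub.card_compl {q k : ℕ} (a : Sub q k) : (a.1ᶜ).card = q := by
  rw [Finset.card_compl, Fintype.card_fin, a.2]; omega

/-- The increasing enumeration `a₁ < ⋯ < a_k`. -/
def Sub.sel {q k : ℕ} (a : Sub q k) : Fin k ↪o Fin (q + k) := a.1.orderEmbOfFin a.2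

/-- The increasing enumeration of the complement of `a`; for a tuple `v`, `v ∘ a.cosel` is `v`
with the entries at `a₁, …, a_k` removed. -/
def Sub.cosel {q k : ℕ} (a : Sub q k) : Fin q ↪o Fin (q + k) := a.1ᶜ.orderEmbOfFin a.card_compl

/-- The sign `(-1)^(a₁ + ⋯ + a_k)`. -/
def Sub.sign (K : Type*) [Field K] {q k : ℕ} (a : Sub q k) : K := (-1) ^ (∑ i ∈ a.1, (i : ℕ))

theorem Sub.sel_mem {q k : ℕ} (a : Sub q k) (m : Fin k) : a.sel m ∈ a.1 :=
  Finset.orderEmbOfFin_mem _ _ _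

theorem Sub.cosel_notMem {q k : ℕ} (a : Sub q k) (m : Fin q) : a.cosel m ∉ a.1 :=
  Finset.mem_compl.1 (Finset.orderEmbOfFin_mem _ _ _)

theorem Sub.exists_sel {q k : ℕ} (a : Sub q k) {i : Fin (q + k)} (h : i ∈ a.1) :
    ∃ m, a.sel m = i := by
  have : i ∈ Set.range (a.1.orderEmbOfFin a.2) := by rw [Finset.range_orderEmbOfFin]; exact h
  exact this

theorem Sub.exists_cosel {q k : ℕ} (a : Sub q k) {i : Fin (q + k)} (h : i ∉ a.1) :
    ∃ m, a.cosel m = i := by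
  have : i ∈ Set.range (a.1ᶜ.orderEmbOfFin a.card_compl) := by
    rw [Finset.range_orderEmbOfFin]; simpa using h
  exact this

/-- The effect on a subset of the transposition of `i` and `j`. -/
def Sub.swap {q k : ℕ} (a : Sub q k) (i j : Fin (q + k)) : Sub q k :=
  ⟨a.1.map (Equiv.swap i j).toEmbedding, by rw [Finset.card_map, a.2]⟩

theorem Sub.mem_swap {q k : ℕ} (a : Sub q k) (i j x : Fin (q + k)) :
    x ∈ (a.swap i j).1 ↔ Equiv.swap i j x ∈ a.1 := by
  simp only [Sub.swap, Finset.mem_map_equiv, Equiv.symm_swap]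

theorem swap_lt_swap {n : ℕ} {i j x y : Fin n} (hj : (j : ℕ) = i + 1) (hxy : x < y)
    (h : ¬ (x = i ∧ y = j)) : Equiv.swap i j x < Equiv.swap i j y := by
  rw [Equiv.swap_apply_def, Equiv.swap_apply_def]
  simp only [Fin.ext_iff, Fin.lt_def] at *
  split_ifs <;> omega

theorem Sub.sel_swap {q k : ℕ} (a : Sub q k) {i j : Fin (q + k)} (hj : (j : ℕ) = i + 1)
    (h : ¬ (i ∈ a.1 ∧ j ∈ a.1)) (m : Fin k) : (a.swap i j).sel m = Equiv.swap i j (a.sel m) := by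
  refine (congrFun (Finset.orderEmbOfFin_unique (a.swap i j).2
    (f := fun m => Equiv.swap i j (a.sel m)) (fun m => ?_) (fun m n hmn => ?_)) m).symm
  · rw [Sub.mem_swap, Equiv.swap_apply_self]; exact a.sel_mem m
  · refine swap_lt_swap hj (a.sel.strictMono hmn) fun h' => h ⟨?_, ?_⟩
    · rw [← h'.1]; exact a.sel_mem m
    · rw [← h'.2]; exact a.sel_mem n

theorem Sub.cosel_swap {q k : ℕ} (a : Sub q k) {i j : Fin (q + k)} (hj : (j : ℕ) = i + 1)
    (h : ¬ (i ∉ a.1 ∧ j ∉ a.1)) (m : Fin q) :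
    (a.swap i j).cosel m = Equiv.swap i j (a.cosel m) := by
  refine (congrFun (Finset.orderEmbOfFin_unique (a.swap i j).card_compl
    (f := fun m => Equiv.swap i j (a.cosel m)) (fun m => ?_) (fun m n hmn => ?_)) m).symm
  · rw [Finset.mem_compl, Sub.mem_swap, Equiv.swap_apply_self]; exact a.cosel_notMem m
  · refine swap_lt_swap hj (a.cosel.strictMono hmn) fun h' => h ⟨?_, ?_⟩
    · rw [← h'.1]; exact a.cosel_notMem m
    · rw [← h'.2]; exact a.cosel_notMem n

theorem Sub.sign_swap {q k : ℕ} (a : Sub q k) {i j : Fin (q + k)} (hj : (j : ℕ) = i + 1)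
    (h : (i ∈ a.1 ∧ j ∉ a.1) ∨ (i ∉ a.1 ∧ j ∈ a.1)) :
    (a.swap i j).sign K = - a.sign K := by
  have hij : i ≠ j := by intro h'; rw [← h'] at hj; omega
  unfold Sub.sign Sub.swap
  rw [Finset.sum_map]
  simp only [Equiv.coe_toEmbedding]
  rcases h with ⟨h1, h2⟩ | ⟨h1, h2⟩
  · rw [← Finset.add_sum_erase _ _ h1, ← Finset.add_sum_erase _ _ h1]
    rw [Finset.sum_congr rfl (g := fun x : Fin (q + k) => (x : ℕ)) fun x hx => ?_]
    · rw [Equiv.swap_apply_left, hj]; ring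
    · rw [Equiv.swap_apply_of_ne_of_ne (Finset.ne_of_mem_erase hx)]
      rintro rfl; exact h2 (Finset.mem_of_mem_erase hx)
  · rw [← Finset.add_sum_erase _ _ h2, ← Finset.add_sum_erase _ _ h2]
    rw [Finset.sum_congr rfl (g := fun x : Fin (q + k) => (x : ℕ)) fun x hx => ?_]
    · rw [Equiv.swap_apply_right, hj]; ring
    · rw [Equiv.swap_apply_of_ne_of_ne _ (Finset.ne_of_mem_erase hx)]
      rintro rfl; exact h1 (Finset.mem_of_mem_erase hx)

/-- One summand of a shuffle sum, as a multilinear map. -/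
def shuffleTerm {k q : ℕ} (F : L [⋀^Fin k]→ₗ[K] (L [⋀^Fin q]→ₗ[K] N)) (a : Sub q k) :
    MultilinearMap K (fun _ : Fin (q + k) => L) N where
  toFun v := F (v ∘ a.sel) (v ∘ a.cosel)
  map_update_add' v i x y := by
    by_cases h : i ∈ a.1
    · obtain ⟨m, rfl⟩ := a.exists_sel h
      have h2 : a.sel m ∉ Set.range a.cosel := by
        rintro ⟨n, hn⟩; exact a.cosel_notMem n (hn ▸ h)
      simp only [Function.update_comp_eq_of_injective v a.sel.injective,
        Function.update_comp_eq_of_notMem_range v _ h2, AlternatingMap.map_update_add,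
        AlternatingMap.add_apply]
    · obtain ⟨m, rfl⟩ := a.exists_cosel h
      have h2 : a.cosel m ∉ Set.range a.sel := by
        rintro ⟨n, hn⟩; exact h (hn ▸ a.sel_mem n)
      simp only [Function.update_comp_eq_of_injective v a.cosel.injective,
        Function.update_comp_eq_of_notMem_range v _ h2, AlternatingMap.map_update_add]
  map_update_smul' v i t x := by
    by_cases h : i ∈ a.1
    · obtain ⟨m, rfl⟩ := a.exists_sel h
      have h2 : a.sel m ∉ Set.range a.cosel := by
        rintro ⟨n, hn⟩; exact a.cosel_notMem n (hn ▸ h)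
      simp only [Function.update_comp_eq_of_injective v a.sel.injective,
        Function.update_comp_eq_of_notMem_range v _ h2, AlternatingMap.map_update_smul,
        AlternatingMap.smul_apply]
    · obtain ⟨m, rfl⟩ := a.exists_cosel h
      have h2 : a.cosel m ∉ Set.range a.sel := by
        rintro ⟨n, hn⟩; exact h (hn ▸ a.sel_mem n)
      simp only [Function.update_comp_eq_of_injective v a.cosel.injective,
        Function.update_comp_eq_of_notMem_range v _ h2, AlternatingMap.map_update_smul]

theorem shuffleTerm_apply {k q : ℕ} (F : L [⋀^Fin k]→ₗ[K] (L [⋀^Fin q]→ₗ[K] N)) (a : Sub q k)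
    (v : Fin (q + k) → L) : shuffleTerm F a v = F (v ∘ a.sel) (v ∘ a.cosel) := rfl

theorem shuffleTerm_eq_zero {k q : ℕ} (F : L [⋀^Fin k]→ₗ[K] (L [⋀^Fin q]→ₗ[K] N)) (a : Sub q k)
    {v : Fin (q + k) → L} {i j : Fin (q + k)} (hv : v i = v j) (hij : i ≠ j)
    (h : i ∈ a.1 ↔ j ∈ a.1) : shuffleTerm F a v = 0 := by
  rw [shuffleTerm_apply]
  by_cases hi : i ∈ a.1
  · obtain ⟨m, rfl⟩ := a.exists_sel hi
    obtain ⟨n, rfl⟩ := a.exists_sel (h.1 hi)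
    rw [F.map_eq_zero_of_eq (v ∘ a.sel) (i := m) (j := n) hv (by rintro rfl; exact hij rfl)]
    rfl
  · obtain ⟨m, rfl⟩ := a.exists_cosel hi
    obtain ⟨n, rfl⟩ := a.exists_cosel (fun h' => hi (h.2 h'))
    exact (F (v ∘ a.sel)).map_eq_zero_of_eq (v ∘ a.cosel) (i := m) (j := n) hv
      (by rintro rfl; exact hij rfl)

/-- The shuffle sum
`v ↦ ∑_{a₁ < ⋯ < a_k} (-1)^(a₁ + ⋯ + a_k) F(v_{a₁}, …, v_{a_k})(v with those entries removed)`. -/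
def shuffle {k q : ℕ} (F : L [⋀^Fin k]→ₗ[K] (L [⋀^Fin q]→ₗ[K] N)) : L [⋀^Fin (q + k)]→ₗ[K] N where
  toMultilinearMap := ∑ a : Sub q k, a.sign K • shuffleTerm F a
  map_eq_zero_of_eq' := by
    refine eq_zero_of_adjacent _ fun v i j hj hv => ?_
    have hij : i ≠ j := by intro h'; rw [← h'] at hj; omega
    have hsw : ∀ x, v (Equiv.swap i j x) = v x := by
      intro x
      rw [Equiv.swap_apply_def]; split_ifs with h1 h2
      · rw [h1, hv]
      · rw [h2, hv]
      · rfl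
    rw [sum_apply]
    simp only [smul_apply]
    refine Finset.sum_involution (fun a _ => a.swap i j) ?_ ?_ (fun _ _ => Finset.mem_univ _) ?_
    · intro a _
      by_cases h : i ∈ a.1 ↔ j ∈ a.1
      · rw [shuffleTerm_eq_zero F a hv hij h, shuffleTerm_eq_zero F (a.swap i j) hv hij]
        · simp
        · rw [Sub.mem_swap, Sub.mem_swap, Equiv.swap_apply_left, Equiv.swap_apply_right]
          exact h.symm
      · have e1 : v ∘ (a.swap i j).sel = v ∘ a.sel := funext fun m => by
          simp only [Function.comp_apply]; rw [a.sel_swap hj (by tauto), hsw]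
        have e2 : v ∘ (a.swap i j).cosel = v ∘ a.cosel := funext fun m => by
          simp only [Function.comp_apply]; rw [a.cosel_swap hj (by tauto), hsw]
        rw [shuffleTerm_apply, shuffleTerm_apply, e1, e2, a.sign_swap hj (by tauto), neg_smul,
          add_neg_cancel]
    · intro a _ hne heq
      apply hne
      have h : i ∈ a.1 ↔ j ∈ a.1 := by
        have := Sub.mem_swap a i j i
        rw [heq, Equiv.swap_apply_left] at this
        exact this
      rw [shuffleTerm_eq_zero F a hv hij h, smul_zero]
    · intro a _
      apply Subtype.ext
      ext x
      rw [Sub.mem_swap, Sub.mem_swap, Equiv.swap_apply_self]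

theorem shuffle_apply {k q : ℕ} (F : L [⋀^Fin k]→ₗ[K] (L [⋀^Fin q]→ₗ[K] N))
    (v : Fin (q + k) → L) :
    shuffle F v = ∑ a : Sub q k, a.sign K • F (v ∘ a.sel) (v ∘ a.cosel) := by
  change (∑ a : Sub q k, a.sign K • shuffleTerm F a) v = _
  rw [sum_apply]; rfl

/-- The shuffle sum as a linear map. -/
def shuffleLM (K L N : Type*) [Field K] [AddCommGroup L] [Module K L] [AddCommGroup N]
    [Module K N] (k q : ℕ) :
    (L [⋀^Fin k]→ₗ[K] (L [⋀^Fin q]→ₗ[K] N)) →ₗ[K] L [⋀^Fin (q + k)]→ₗ[K] N where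
  toFun := shuffle
  map_add' F G := by
    ext v; simp [shuffle_apply, Finset.sum_add_distrib]
  map_smul' t F := by
    ext v; simp [shuffle_apply, Finset.smul_sum, smul_comm t]

/-- The derivation extension
`(D ω)(x₁, …, x_r) = ∑_k ω(x₁, …, D x_k, …, x_r)`. -/
def altDeriv {n : ℕ} (D : L →ₗ[K] L) (ω : L [⋀^Fin n]→ₗ[K] N) : L [⋀^Fin n]→ₗ[K] N where
  toMultilinearMap := ∑ k : Fin n, ω.toMultilinearMap.compLinearMap
    (Function.update (fun _ => LinearMap.id) k D)
  map_eq_zero_of_eq' v i j hv hij := by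
    have key : ∀ k, ω.toMultilinearMap.compLinearMap
        (Function.update (fun _ => LinearMap.id) k D) v = ω (Function.update v k (D (v k))) := by
      intro k
      rw [MultilinearMap.compLinearMap_apply, AlternatingMap.coe_multilinearMap]
      congr 1; ext l
      by_cases h : l = k
      · subst h; simp
      · simp [h]
    change (∑ k : Fin n, ω.toMultilinearMap.compLinearMap
      (Function.update (fun _ => LinearMap.id) k D)) v = 0
    rw [sum_apply]
    simp only [key]
    rw [← Finset.add_sum_erase _ _ (Finset.mem_univ i),
      ← Finset.add_sum_erase _ _ (Finset.mem_erase.2 ⟨hij.symm, Finset.mem_univ j⟩), ← add_assoc]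
    rw [Finset.sum_eq_zero fun k hk => ?_, add_zero]
    · have : Function.update v j (D (v j)) =
          Function.update v i (D (v i)) ∘ Equiv.swap i j := by
        ext l
        simp only [Function.comp_apply, Equiv.swap_apply_def]
        split_ifs with h1 h2
        · subst h1; simp [hij, hij.symm, hv]
        · subst h2; simp [hv]
        · simp [h1, h2]
      rw [this, ω.map_swap _ hij, add_neg_cancel]
    · have h1 : k ≠ j := Finset.ne_of_mem_erase hk
      have h2 : k ≠ i := Finset.ne_of_mem_erase (Finset.mem_of_mem_erase hk)
      exact ω.map_eq_zero_of_eq _ (i := i) (j := j) (by simp [h1.symm, h2.symm, hv]) hij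

theorem altDeriv_apply {n : ℕ} (D : L →ₗ[K] L) (ω : L [⋀^Fin n]→ₗ[K] N) (v : Fin n → L) :
    altDeriv D ω v = ∑ k : Fin n, ω (Function.update v k (D (v k))) := by
  change (∑ k : Fin n, ω.toMultilinearMap.compLinearMap
    (Function.update (fun _ => LinearMap.id) k D)) v = _
  rw [sum_apply]
  refine Finset.sum_congr rfl fun k _ => ?_
  rw [MultilinearMap.compLinearMap_apply, AlternatingMap.coe_multilinearMap]
  congr 1; ext l
  by_cases h : l = k
  · subst h; simp
  · simp [h]

end Alternating

/-! ### The Chevalley-Eilenberg differential -/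

section ChevalleyEilenberg

variable {K : Type*} [Field K] {L M : Type*} [LieRing L] [LieAlgebra K L]
  [AddCommGroup M] [Module K M]

/-- `(x, y) ↦ ω([x, y], ·)`. -/
def bracketContract {q : ℕ} (ω : L [⋀^Fin (q + 1)]→ₗ[K] M) :
    L [⋀^Fin 2]→ₗ[K] (L [⋀^Fin q]→ₗ[K] M) where
  toFun v := ω.curryLeft ⁅v 0, v 1⁆
  map_update_add' v i x y := by fin_cases i <;> simp
  map_update_smul' v i t x := by fin_cases i <;> simp
  map_eq_zero_of_eq' v i j hv hij := by
    have : v 0 = v 1 := by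
      fin_cases i <;> fin_cases j <;> simp_all
    simp [this]

theorem bracketContract_apply {q : ℕ} (ω : L [⋀^Fin (q + 1)]→ₗ[K] M) (v : Fin 2 → L)
    (w : Fin q → L) : bracketContract ω v w = ω (Matrix.vecCons ⁅v 0, v 1⁆ w) := rfl

/-- The bracket part of the Chevalley-Eilenberg differential,
`X ↦ ∑_{m < n} (-1)^(m + n) ω([x_m, x_n], X(m, n))`. -/
def ceBracket : (q : ℕ) → (L [⋀^Fin q]→ₗ[K] M) →ₗ[K] L [⋀^Fin (q + 1)]→ₗ[K] M
  | 0 => 0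
  | q + 1 => shuffleLM K L M 2 q ∘ₗ
      { toFun := bracketContract
        map_add' := fun ω η => by ext v w; simp [bracketContract_apply]
        map_smul' := fun t ω => by ext v w; simp [bracketContract_apply] }

/-- The Chevalley-Eilenberg differential of `L` with values in `M`,
`(δ ω)(X) = ∑_j (-1)^j ρ(x_j) ω(X(j)) + ∑_{m < n} (-1)^(m + n) ω([x_m, x_n], X(m, n))`. -/
def ceDiff (ρ : L →ₗ[K] Module.End K M) (q : ℕ) :
    (L [⋀^Fin q]→ₗ[K] M) →ₗ[K] L [⋀^Fin (q + 1)]→ₗ[K] M :=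
  AlternatingMap.alternatizeUncurryFinLM ∘ₗ
    { toFun := fun ω =>
        { toFun := fun x => (ρ x).compAlternatingMap ω
          map_add' := fun x y => by ext v; simp
          map_smul' := fun t x => by ext v; simp }
      map_add' := fun ω η => by ext x v; simp
      map_smul' := fun t ω => by ext x v; simp } +
  ceBracket q

theorem ceDiff_apply_zero (ρ : L →ₗ[K] Module.End K M) (ω : L [⋀^Fin 0]→ₗ[K] M)
    (X : Fin 1 → L) : ceDiff ρ 0 ω X = ρ (X 0) (ω ![]) := by
  simp [ceDiff, ceBracket, AlternatingMap.alternatizeUncurryFin_apply,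
    Subsingleton.elim (Fin.removeNth 0 X) ![]]

theorem ceDiff_apply_succ (ρ : L →ₗ[K] Module.End K M) (q : ℕ) (ω : L [⋀^Fin (q + 1)]→ₗ[K] M)
    (X : Fin (q + 2) → L) :
    ceDiff ρ (q + 1) ω X =
      ∑ j : Fin (q + 2), (-1 : ℤ) ^ (j : ℕ) • ρ (X j) (ω (Fin.removeNth j X)) +
      ∑ a : Sub q 2, a.sign K • ω (Matrix.vecCons ⁅X (a.sel 0), X (a.sel 1)⁆ (X ∘ a.cosel)) := by
  change AlternatingMap.alternatizeUncurryFin _ X + shuffle (bracketContract ω) X = _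
  rw [AlternatingMap.alternatizeUncurryFin_apply, shuffle_apply]
  rfl

end ChevalleyEilenberg

/-! ### The cochains -/

section Cochains

variable {K : Type*} [Field K] {g h W V : Type u} [LieRing g] [LieAlgebra K g]
  [LieRing h] [LieAlgebra K h] [AddCommGroup W] [Module K W] [AddCommGroup V] [Module K V]

/-- The coefficients: `V` for `r = 0`, and `⋀^r g^* ⊗ W`, realised as the alternating
`r`-linear maps `g^r → W`, for `r > 0`. -/
def Coef (K : Type*) [Field K] (g W V : Type u) [LieRing g] [LieAlgebra K g]
    [AddCommGroup W] [Module K W] [AddCommGroup V] [Module K V] : ℕ → Type u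
  | 0 => V
  | r + 1 => g [⋀^Fin (r + 1)]→ₗ[K] W

instance Coef.addCommGroup : (r : ℕ) → AddCommGroup (Coef K g W V r)
  | 0 => inferInstanceAs (AddCommGroup V)
  | r + 1 => inferInstanceAs (AddCommGroup (g [⋀^Fin (r + 1)]→ₗ[K] W))

instance Coef.module : (r : ℕ) → Module K (Coef K g W V r)
  | 0 => inferInstanceAs (Module K V)
  | r + 1 => inferInstanceAs (Module K (g [⋀^Fin (r + 1)]→ₗ[K] W))

variable {X : CrossedModule K g h} {φ : W →ₗ[K] V}

/-- `ρ^{(r)}(y) ω (x₁, …, x_r) = ρ₀¹(y) ω(x₁, …, x_r) - ∑_k ω(x₁, …, 𝓛_y x_k, …, x_r)`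
on `⋀^r g^* ⊗ W`. -/
def hochRep (ρ : TwoRep X φ) (r : ℕ) : h →ₗ[K] Module.End K (g [⋀^Fin r]→ₗ[K] W) where
  toFun y :=
    { toFun := fun ω => (ρ.onW y).compAlternatingMap ω - altDeriv (X.act y : g →ₗ[K] g) ω
      map_add' := fun ω η => by
        ext v; simp [altDeriv_apply, Finset.sum_add_distrib]; abel
      map_smul' := fun t ω => by
        ext v; simp [altDeriv_apply, Finset.smul_sum, smul_sub] }
  map_add' y z := by
    ext ω v; simp [altDeriv_apply, Finset.sum_add_distrib]; abel
  map_smul' t y := by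
    ext ω v; simp [altDeriv_apply, Finset.smul_sum, smul_sub]

theorem hochRep_apply (ρ : TwoRep X φ) (r : ℕ) (y : h) (ω : g [⋀^Fin r]→ₗ[K] W) (x : Fin r → g) :
    hochRep ρ r y ω x =
      ρ.onW y (ω x) - ∑ k : Fin r, ω (Function.update x k (X.act y (x k))) := by
  change (ρ.onW y).compAlternatingMap ω x - altDeriv (X.act y : g →ₗ[K] g) ω x = _
  rw [altDeriv_apply]; rfl

/-- The representation of `h` on the coefficients: `ρ₀⁰` on `V` for `r = 0`, and `ρ^{(r)}` on
`⋀^r g^* ⊗ W` for `r > 0`. -/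
def coefRep (ρ : TwoRep X φ) : (r : ℕ) → h →ₗ[K] Module.End K (Coef K g W V r)
  | 0 => ρ.onV
  | r + 1 => hochRep ρ (r + 1)

/-- `v ↦ (x ↦ ρ₁(x) v)`, as a map `V → g^* ⊗ W`. -/
def arrowDiff (ρ : TwoRep X φ) : V →ₗ[K] g [⋀^Fin 1]→ₗ[K] W where
  toFun v := AlternatingMap.ofSubsingleton K g W (0 : Fin 1) (ρ.arrow.flip v)
  map_add' v w := by rw [map_add]; rfl
  map_smul' t v := by rw [map_smul]; rfl

theorem arrowDiff_apply (ρ : TwoRep X φ) (v : V) (x : Fin 1 → g) :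
    arrowDiff ρ v x = ρ.arrow (x 0) v := rfl

/-- The differential of the complex `V → g^* ⊗ W → ⋀² g^* ⊗ W → ⋯`: it is `v ↦ (x ↦ ρ₁(x) v)` in
degree `0` and the Chevalley-Eilenberg differential of `g` with values in the representation
`ρ₀¹ ∘ μ` on `W` in positive degrees. -/
def coefDiff (ρ : TwoRep X φ) : (r : ℕ) → Coef K g W V r →ₗ[K] Coef K g W V (r + 1)
  | 0 => arrowDiff ρ
  | r + 1 => ceDiff (ρ.onW ∘ₗ (X.mu : g →ₗ[K] h)) (r + 1)

/-- `x ↦ (ω ↦ φ(ω(x)))`. -/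
def contractOne (φ : W →ₗ[K] V) : g →ₗ[K] (g [⋀^Fin 1]→ₗ[K] W) →ₗ[K] V where
  toFun x :=
    { toFun := fun ω => φ (ω fun _ => x)
      map_add' := fun ω η => by simp
      map_smul' := fun t ω => by simp }
  map_add' x y := by
    ext ω
    have := ω.map_update_add (fun _ => 0) 0 x y
    simp only [Function.update_eq_const_of_subsingleton] at this
    change φ (ω fun _ => x + y) = φ (ω fun _ => x) + φ (ω fun _ => y)
    rw [← map_add φ]
    exact congrArg φ this
  map_smul' t x := by
    ext ω
    have := ω.map_update_smul (fun _ => 0) 0 t x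
    simp only [Function.update_eq_const_of_subsingleton] at this
    change φ (ω fun _ => t • x) = t • φ (ω fun _ => x)
    rw [← map_smul φ]
    exact congrArg φ this

/-- `x ↦ (ω ↦ ω(x, ·))`. -/
def contractLeft (K g W : Type*) [Field K] [AddCommGroup g] [Module K g] [AddCommGroup W]
    [Module K W] (r : ℕ) : g →ₗ[K] (g [⋀^Fin (r + 1)]→ₗ[K] W) →ₗ[K] (g [⋀^Fin r]→ₗ[K] W) :=
  (AlternatingMap.curryLeftLinearMap :
    (g [⋀^Fin (r + 1)]→ₗ[K] W) →ₗ[K] g →ₗ[K] (g [⋀^Fin r]→ₗ[K] W)).flip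

theorem contractLeft_apply {K g W : Type*} [Field K] [AddCommGroup g] [Module K g]
    [AddCommGroup W] [Module K W] (r : ℕ) (x : g) (ω : g [⋀^Fin (r + 1)]→ₗ[K] W) (v : Fin r → g) :
    contractLeft K g W r x ω v = ω (Matrix.vecCons x v) := rfl

/-- Insertion of an element of `g` in the first slot, `x ↦ ω(x, ·)`; for `r = 1` the result
`ω(x) ∈ W` is mapped to `V` by `φ`. -/
def contract (φ : W →ₗ[K] V) : (r : ℕ) → g →ₗ[K] Coef K g W V r →ₗ[K] Coef K g W V (r - 1)
  | 0 => 0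
  | 1 => contractOne φ
  | r + 2 => contractLeft K g W (r + 1)

theorem contract_contract (φ : W →ₗ[K] V) (r : ℕ) (x : g) (ω : Coef K g W V r) :
    contract φ (r - 1) x (contract φ r x ω) = 0 := by
  match r with
  | 0 => rfl
  | 1 => rfl
  | 2 =>
    have key : ∀ η : g [⋀^Fin 2]→ₗ[K] W, contractOne φ x (contractLeft K g W 1 x η) = 0 := by
      intro η
      have : η (Matrix.vecCons x fun _ => x) = 0 :=
        η.map_eq_zero_of_eq _ (i := 0) (j := 1) rfl (by simp)
      exact (congrArg φ this).trans (map_zero φ)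
    exact key ω
  | r + 3 => exact AlternatingMap.curryLeft_same (n := r + 1) (show g [⋀^Fin (r + 3)]→ₗ[K] W from ω) x

/-- Successive insertions `(x₁, …, x_k) ↦ (ω ↦ ω(x₁, …, x_k, ·))`, as a multilinear map. -/
def insertMul (φ : W →ₗ[K] V) (r : ℕ) : (k : ℕ) →
    MultilinearMap K (fun _ : Fin k => g) (Coef K g W V r →ₗ[K] Coef K g W V (r - k))
  | 0 => MultilinearMap.constOfIsEmpty K _ LinearMap.id
  | k + 1 => MultilinearMap.uncurryRight
      ((LinearMap.mk₂ K (fun (f : Coef K g W V r →ₗ[K] Coef K g W V (r - k)) (x : g) =>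
        (contract φ (r - k) x ∘ₗ f : Coef K g W V r →ₗ[K] Coef K g W V (r - (k + 1))))
        (fun f f' x => by rw [LinearMap.comp_add])
        (fun t f x => by rw [LinearMap.comp_smul])
        (fun f x y => by rw [map_add, LinearMap.add_comp])
        (fun t f x => by rw [map_smul, LinearMap.smul_comp])).compMultilinearMap
        (insertMul φ r k))

theorem insertMul_succ (φ : W →ₗ[K] V) (r k : ℕ) (x : Fin (k + 1) → g) (ω : Coef K g W V r) :
    insertMul φ r (k + 1) x ω =
      contract φ (r - k) (x (Fin.last k)) (insertMul φ r k (Fin.init x) ω) := rfl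

theorem insertMul_adjacent (φ : W →ₗ[K] V) (r k : ℕ) (x : Fin k → g) (i j : Fin k)
    (hj : (j : ℕ) = i + 1) (hx : x i = x j) :
    insertMul (V := V) φ r k x = 0 := by
  induction k with
  | zero => exact i.elim0
  | succ k ih =>
    refine LinearMap.ext fun ω => ?_
    rw [insertMul_succ]
    by_cases hl : (j : ℕ) = k
    · match k with
      | 0 => omega
      | k + 1 =>
        rw [insertMul_succ]
        have e1 : j = Fin.last (k + 1) := Fin.ext hl
        have e2 : i = (Fin.last k).castSucc := Fin.ext (by simp; omega)
        have e3 : Fin.init x (Fin.last k) = x (Fin.last (k + 1)) := by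
          rw [← e1, ← hx, e2]; rfl
        rw [e3]
        exact contract_contract φ (r - k) _ _
    · have hi := i.2
      have hj' := j.2
      rw [ih (Fin.init x) ⟨i, by omega⟩ ⟨j, by omega⟩ hj hx]
      exact map_zero _

/-- Successive insertions `(x₁, …, x_k) ↦ (ω ↦ ω(x₁, …, x_k, ·))`, with values in the
coefficients of degree `r - k`; for `k = r > 0` the result is mapped to `V` by `φ`. -/
def insertAlt (φ : W →ₗ[K] V) (r k : ℕ) :
    g [⋀^Fin k]→ₗ[K] (Coef K g W V r →ₗ[K] Coef K g W V (r - k)) where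
  toMultilinearMap := insertMul φ r k
  map_eq_zero_of_eq' := eq_zero_of_adjacent _ fun x i j hj hx => insertMul_adjacent φ r k x i j hj hx

/-- The space `C^{p,q}_r = ⋀^q g_p^* ⊗ ⋀^r g^* ⊗ W` (`⋀^q g_p^* ⊗ V` for `r = 0`), realised as
alternating `q`-linear maps on `g_p` with values in the coefficients of degree `r`. -/
abbrev Cochain (X : CrossedModule K g h) (W V : Type u) [AddCommGroup W] [Module K W]
    [AddCommGroup V] [Module K V] (p q r : ℕ) : Type u :=
  Nerve X p [⋀^Fin q]→ₗ[K] Coef K g W V r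

variable (ρ : TwoRep X φ)

/-- `δ^{(r)}`: the Chevalley-Eilenberg differential of `g_p` with values in the pull-back of the
representation on the coefficients along the final target map. -/
def dQ (p q r : ℕ) : Cochain X W V p q r →ₗ[K] Cochain X W V p (q + 1) r :=
  ceDiff (coefRep ρ r ∘ₗ Nerve.vertex X 0) q

/-- `δ_{(1)}`: the differential in the coefficients. -/
def dR (p q r : ℕ) : Cochain X W V p q r →ₗ[K] Cochain X W V p q (r + 1) :=
  { toFun := fun ω => (coefDiff ρ r).compAlternatingMap ω
    map_add' := fun ω η => by ext Ξ; simp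
    map_smul' := fun t ω => by ext Ξ; simp }

/-- Pull-back of alternating maps along a linear map. -/
def pullback {L L' M : Type*} [AddCommGroup L] [Module K L] [AddCommGroup L'] [Module K L']
    [AddCommGroup M] [Module K M] {q : ℕ} (f : L →ₗ[K] L') :
    (L' [⋀^Fin q]→ₗ[K] M) →ₗ[K] L [⋀^Fin q]→ₗ[K] M where
  toFun ω := ω.compLinearMap f
  map_add' ω η := by ext v; simp
  map_smul' t ω := by ext v; simp

/-- `∂ = ∑_k (-1)^k ∂_k^*`: the differential of groupoid cochains. -/
def dP (X : CrossedModule K g h) (W V : Type u) [AddCommGroup W] [Module K W]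
    [AddCommGroup V] [Module K V] (p q r : ℕ) :
    Cochain X W V p q r →ₗ[K] Cochain X W V (p + 1) q r :=
  ∑ k : Fin (p + 2), (-1 : K) ^ (k : ℕ) • pullback (Nerve.face X k)

/-- The difference map
`Δ_k ω(Ξ; Z) = ∑_{a₁ < ⋯ < a_k} (-1)^(a₁ + ⋯ + a_k) ω(∂_0 Ξ(a₁, …, a_k); x_{a₁}⁰, …, x_{a_k}⁰, Z)`,
composed with `φ` for `k = r`. -/
def shuffleDiff (X : CrossedModule K g h) (φ : W →ₗ[K] V) (p q r k : ℕ) :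
    Cochain X W V p q r →ₗ[K] Cochain X W V (p + 1) (q + k) (r - k) :=
  shuffleLM K (Nerve X (p + 1)) (Coef K g W V (r - k)) k q ∘ₗ
    { toFun := fun ω =>
        ({ toFun := fun f => f.compAlternatingMap (ω.compLinearMap (Nerve.face X 0))
           map_add' := fun f f' => by ext Ξ; simp
           map_smul' := fun t f => by ext Ξ; simp } :
          (Coef K g W V r →ₗ[K] Coef K g W V (r - k)) →ₗ[K]
            (Nerve X (p + 1) [⋀^Fin q]→ₗ[K] Coef K g W V (r - k))).compAlternatingMap
          ((insertAlt φ r k).compLinearMap (Nerve.coord X 0))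
      map_add' := fun ω η => by ext x Ξ; simp
      map_smul' := fun t ω => by ext x Ξ; simp }

theorem shuffleDiff_apply (p q r k : ℕ) (ω : Cochain X W V p q r)
    (Ξ : Fin (q + k) → Nerve X (p + 1)) :
    shuffleDiff X φ p q r k ω Ξ = ∑ a : Sub q k, a.sign K •
      insertAlt φ r k (fun m => Nerve.coord X 0 (Ξ (a.sel m)))
        (ω fun m => Nerve.face X 0 (Ξ (a.cosel m))) := by
  change shuffle _ Ξ = _
  rw [shuffle_apply]; rfl

/-- The difference maps `Δ_k` for `k ≥ 1`, with the convention `Δ_0 = ∂`. -/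
def Δ (X : CrossedModule K g h) (φ : W →ₗ[K] V) (p q r : ℕ) : (k : ℕ) →
    Cochain X W V p q r →ₗ[K] Cochain X W V (p + 1) (q + k) (r - k)
  | 0 => dP X W V p q r
  | k + 1 => shuffleDiff X φ p q r (k + 1)

/-- The inclusion of `C^{p,q}_r` in the direct sum of all these spaces. -/
def incl {p q r : ℕ} : Cochain X W V p q r →ₗ[K]
    ⨁ t : ℕ × ℕ × ℕ, Cochain X W V t.1 t.2.1 t.2.2 :=
  DirectSum.lof K (ℕ × ℕ × ℕ) (fun t => Cochain X W V t.1 t.2.1 t.2.2) (p, q, r)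

/-- The triples `(p, q, r)` with `p + q + r = n`. -/
abbrev Triple (n : ℕ) : Type := {t : ℕ × ℕ × ℕ // t.1 + t.2.1 + t.2.2 = n}

/-- `C^n_tot = ⨁_{p + q + r = n} C^{p,q}_r`. -/
abbrev Ctot (X : CrossedModule K g h) (W V : Type u) [AddCommGroup W] [Module K W]
    [AddCommGroup V] [Module K V] (n : ℕ) : Type u :=
  ⨁ t : Triple n, Cochain X W V t.1.1 t.1.2.1 t.1.2.2

/-- The inclusion of `C^{p,q}_r` in `C^n_tot`, `n = p + q + r`. -/
def inclTot {n : ℕ} (p q r : ℕ) (hn : p + q + r = n) : Cochain X W V p q r →ₗ[K] Ctot X W V n :=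
  DirectSum.lof K (Triple n) (fun t => Cochain X W V t.1.1 t.1.2.1 t.1.2.2) ⟨(p, q, r), hn⟩

/-- The restriction of the total differential to `C^{p,q}_r`:
`δ^{(r)} + (-1)^q δ_{(1)} + (-1)^(q + r) ∂ + ∑_{k = 1}^r (-1)^(r + q (k + 1) + k (k - 1) / 2) Δ_k`. -/
def nablaAt (n p q r : ℕ) (hn : p + q + r = n) :
    Cochain X W V p q r →ₗ[K] Ctot X W V (n + 1) :=
  inclTot p (q + 1) r (by omega) ∘ₗ dQ ρ p q r
  + (-1 : K) ^ q • (inclTot p q (r + 1) (by omega) ∘ₗ dR ρ p q r)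
  + (-1 : K) ^ (q + r) • (inclTot (p + 1) q r (by omega) ∘ₗ dP X W V p q r)
  + ∑ k : Finset.Icc 1 r, (-1 : K) ^ (r + q * (k.1 + 1) + k.1 * (k.1 - 1) / 2) •
      (inclTot (p + 1) (q + k.1) (r - k.1)
        (by have := Finset.mem_Icc.1 k.2; omega) ∘ₗ Δ X φ p q r k.1)

/-- The total differential `∇ : C^n_tot → C^{n+1}_tot`. -/
def nabla (n : ℕ) : Ctot X W V n →ₗ[K] Ctot X W V (n + 1) :=
  DirectSum.toModule K (Triple n) _ fun t => nablaAt ρ n t.1.1 t.1.2.1 t.1.2.2 t.2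

end Cochains

end LieTwo

end

noncomputable section

set_option linter.unusedSectionVars false

namespace LieTwo

/-! ### Cochains as functions on lists

A `q`-cochain is recorded as a function on lists,
supported on the lists of length `q`; the operators
below are then defined by recursion on lists, independently of the degrees. -/

namespace ListCochain

variable {K : Type*} [Field K] {L L' N : Type*} [AddCommGroup N] [Module K N]

/-! The coefficients of all degrees form one graded space `N = V ⊕ (g^* ⊗ W) ⊕ (⋀² g^* ⊗ W) ⊕ ⋯`
with a Cartan calculus: a differential `d`, insertions `ι_x` (ending in `V` through `φ`), and Lie
derivatives `L_y` for `y ∈ h`. These satisfy `d² = 0`, `ι_x d + d ι_x = L_{μ x}`, `[L_y, ι_x] =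
ι_{𝓛_y x}`, `[L_y, d] = 0`, the insertions anticommute, and `L` is a representation. The axioms of
the crossed module and of the 2-representation enter there; on the nerve, the former are also used
to show that faces and vertices respect brackets.

In this language `Δ_k` pulls back along `∂_0` and then takes the signed sum over `k` removed
entries, each acting by `ι_{x^0}`. Two facts about such sums carry the proof.

Identity i): on `g_{p+1}` one has `v_0 = v_1 + μ(x^0)`, so `ι_{x^0}` is a homotopy between the
actions through `v_0` and `v_1`, and pull-back along `∂_0` turns the former action on `g_p` into the
latter on `g_{p+1}`. The general statement about homotopies is `ce_diff_apply`. Identity ii) is the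
case `k = r`, where `Δ_{r+1}` vanishes on `C^{p,q}_r`.

Identity iii): for anticommuting families `u` and `w`, the sums for `u` and `w` compose to those for
`u + w` (`sum_diff_diff`). Hence the composites through `∂_0 ∂_0` assemble to insertions of `x^0 +
x^1`, the first coordinate of `∂_1`, and cancel the term of `∂_1`; the other faces cancel by the
simplicial identities (`sum_listΔ`).

Finally `∇² = 0` follows by collecting terms: the sign of `∂` is the sign of `Δ_k` at `k = 0`, and
the product of the signs of two successive difference maps depends only on `q` and the sum of their
indices.

Replacing alternating maps by functions on lists, supported in one length, turns every operator into
a recursion on the first argument. The identities become inductions on lists, free of casts between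
degrees. -/

/-- Insertion of an element in the first slot. -/
def ins (ξ : L) (F : List L → N) : List L → N := fun l => F (ξ :: l)

/-- An endomorphism of the coefficients, applied to a cochain. -/
def coef (A : Module.End K N) (F : List L → N) : List L → N := fun l => A (F l)

/-- The values at a list of the derivation extension of `f`. -/
def derAux (K : Type*) [Field K] {L N : Type*} [AddCommGroup N] [Module K N] (f : L → L) :
    List L → (List L → N) →ₗ[K] N
  | [] => 0
  | η :: l => LinearMap.proj (R := K) (φ := fun _ => N) (f η :: l) +
    derAux K f l ∘ₗ LinearMap.funLeft K N (η :: ·)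

/-- The derivation extension `(ξ₁, …, ξ_q) ↦ ∑_k F(ξ₁, …, f ξ_k, …, ξ_q)`. -/
def der (K : Type*) [Field K] {L N : Type*} [AddCommGroup N] [Module K N] (f : L → L) :
    (List L → N) →ₗ[K] (List L → N) := LinearMap.pi (derAux K f)

/-- The values at a list of the difference map. -/
def diffAux (u : L → Module.End K N) : ℕ → List L → (List L → N) →ₗ[K] N
  | 0, l => LinearMap.proj (R := K) (φ := fun _ => N) l
  | _ + 1, [] => 0
  | k + 1, ξ :: l =>
      (-1 : K) ^ (k + 1) • (diffAux u (k + 1) l ∘ₗ LinearMap.funLeft K N (ξ :: ·)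
        - diffAux u k l ∘ₗ (u ξ).compLeft (List L))

/-- The difference map: the signed sum over `a₁ < ⋯ < a_k` of `u ξ_{a_k} ⋯ u ξ_{a_1} F(…)`, where
the entries `ξ_{a_j}` are removed from the arguments of `F`. -/
def diff (u : L → Module.End K N) (k : ℕ) : (List L → N) →ₗ[K] (List L → N) :=
  LinearMap.pi (diffAux u k)

/-- The difference map of the preceding degree. -/
def diffPred (u : L → Module.End K N) : ℕ → (List L → N) →ₗ[K] (List L → N)
  | 0 => 0
  | k + 1 => diff u k

/-- The values at a list of the Chevalley-Eilenberg differential. -/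
def ceAux [Bracket L L] (ρ : L → Module.End K N) : List L → (List L → N) →ₗ[K] N
  | [] => 0
  | ξ :: l => ρ ξ ∘ₗ LinearMap.proj (R := K) (φ := fun _ => N) l - derAux K (fun η => ⁅ξ, η⁆) l
      - ceAux ρ l ∘ₗ LinearMap.funLeft K N (ξ :: ·)

/-- The Chevalley-Eilenberg differential. -/
def ce [Bracket L L] (ρ : L → Module.End K N) : (List L → N) →ₗ[K] (List L → N) :=
  LinearMap.pi (ceAux ρ)

/-- Pull-back along a map. -/
def pull (K : Type*) [Field K] {L L' N : Type*} [AddCommGroup N] [Module K N] (f : L → L') :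
    (List L' → N) →ₗ[K] (List L → N) := LinearMap.funLeft K N (List.map f)

section Recursion

variable (u : L → Module.End K N) (A : Module.End K N) (f : L → L) (F G : List L → N) (l : List L)
  (ξ η : L)

theorem ins_apply : ins ξ F l = F (ξ :: l) := rfl
theorem coef_apply : coef A F l = A (F l) := rfl
theorem ins_coef : ins ξ (coef A F) = coef A (ins ξ F) := rfl
theorem pull_apply (f : L → L') (F : List L' → N) : pull K f F l = F (l.map f) := rfl
theorem ins_pull (f : L → L') (F : List L' → N) : ins ξ (pull K f F) = pull K f (ins (f ξ) F) := rfl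
theorem coef_pull (f : L → L') (F : List L' → N) : coef A (pull K f F) = pull K f (coef A F) := rfl

theorem der_nil : der K f F [] = 0 := rfl
theorem der_cons : der K f F (η :: l) = F (f η :: l) + der K f (ins η F) l := rfl
theorem ins_der : ins η (der K f F) = ins (f η) F + der K f (ins η F) := rfl

theorem diff_zero : diff u 0 F = F := funext fun l => by cases l <;> rfl
theorem diff_succ_nil (k : ℕ) : diff u (k + 1) F [] = 0 := rfl
theorem diffPred_succ (k : ℕ) : diffPred u (k + 1) = diff u k := rfl
theorem diff_cons (k : ℕ) : diff u k F (ξ :: l) =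
    (-1 : K) ^ k • (diff u k (ins ξ F) l - diffPred u k (coef (u ξ) F) l) := by
  cases k
  · simp [diff_zero, diffPred, ins]
  · rfl
theorem ins_diff (k : ℕ) : ins ξ (diff u k F) =
    (-1 : K) ^ k • (diff u k (ins ξ F) - diffPred u k (coef (u ξ) F)) :=
  funext fun _ => diff_cons ..

theorem ce_nil [Bracket L L] : ce u F [] = 0 := rfl
theorem ce_cons [Bracket L L] : ce u F (ξ :: l) =
    u ξ (F l) - der K (fun η => ⁅ξ, η⁆) F l - ce u (ins ξ F) l := rfl
theorem ins_ce [Bracket L L] : ins ξ (ce u F) =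
    coef (u ξ) F - der K (fun η => ⁅ξ, η⁆) F - ce u (ins ξ F) := rfl

end Recursion

/-! ### Commutation rules for the recursive operators -/

section Commutation

theorem coef_der (A : Module.End K N) (f : L → L) (F : List L → N) :
    coef A (der K f F) = der K f (coef A F) := by
  ext l
  induction l generalizing F with
  | nil => simp [coef_apply, der_nil]
  | cons η l ih =>
    have := ih (ins η F)
    simp only [coef_apply, der_cons, map_add, ins_coef] at *
    rw [this]

theorem neg_one_pow_sq (k : ℕ) : (-1 : K) ^ k * (-1 : K) ^ k = 1 := by
  rw [← mul_pow]; simp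

/-- Each of the `k` operators `u ξ` that `A` has to pass contributes one sign. -/
theorem coef_diff_apply {A : Module.End K N} {u : L → Module.End K N}
    (hA : ∀ ξ n, A (u ξ n) = - u ξ (A n)) (k : ℕ) (F : List L → N) (l : List L) :
    A (diff u k F l) = (-1 : K) ^ k • diff u k (coef A F) l := by
  induction l generalizing F k with
  | nil =>
    cases k
    · simp [diff_zero, coef_apply]
    · simp [diff_succ_nil]
  | cons ξ l ih =>
    have h1 := ih k (ins ξ F)
    have hc : coef A (coef (u ξ) F) = (-1 : K) • coef (u ξ) (coef A F) := by
      ext m; simp [coef_apply, hA]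
    have h2 : A (diffPred u k (coef (u ξ) F) l) =
        (-1 : K) ^ k • diffPred u k (coef (u ξ) (coef A F)) l := by
      cases k with
      | zero => simp [diffPred]
      | succ k =>
        have := ih k (coef (u ξ) F)
        simp only [diffPred]
        rw [this, hc, map_smul, Pi.smul_apply]
        module
    rw [diff_cons, diff_cons, map_smul, map_sub, h1, h2, ins_coef, smul_sub, smul_sub, smul_sub]

theorem coef_diff {A : Module.End K N} {u : L → Module.End K N}
    (hA : ∀ ξ n, A (u ξ n) = - u ξ (A n)) (k : ℕ) (F : List L → N) :
    coef A (diff u k F) = (-1 : K) ^ k • diff u k (coef A F) :=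
  funext fun l => coef_diff_apply hA k F l

/-- The term with second index `0` vanishes and the others shift by one. This and its mirror image
reindex the sums in the induction step of `sum_diff_diff`. -/
theorem sum_diff_diffPred (u w : L → Module.End K N) (k : ℕ) (F : List L → N) :
    ∑ i ∈ Finset.HasAntidiagonal.antidiagonal (k + 1), diff u i.1 (diffPred w i.2 F) =
      ∑ i ∈ Finset.HasAntidiagonal.antidiagonal k, diff u i.1 (diff w i.2 F) := by
  rw [Finset.Nat.sum_antidiagonal_succ']
  simp [diffPred]

theorem sum_diffPred_diff (u w : L → Module.End K N) (k : ℕ) (F : List L → N) :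
    ∑ i ∈ Finset.HasAntidiagonal.antidiagonal (k + 1), diffPred u i.1 (diff w i.2 F) =
      ∑ i ∈ Finset.HasAntidiagonal.antidiagonal k, diff u i.1 (diff w i.2 F) := by
  rw [Finset.Nat.sum_antidiagonal_succ]
  simp [diffPred]

/-- The difference maps of a sum. -/
theorem sum_diff_diff {u w : L → Module.End K N}
    (huw : ∀ ξ η n, u ξ (w η n) = - w η (u ξ n)) (k : ℕ) (F : List L → N) :
    ∑ i ∈ Finset.HasAntidiagonal.antidiagonal k, diff u i.1 (diff w i.2 F) =
      diff (fun ξ => u ξ + w ξ) k F := by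
  ext l
  rw [Finset.sum_apply]
  induction l generalizing F k with
  | nil =>
    cases k with
    | zero => simp [diff_zero]
    | succ k =>
      rw [Finset.Nat.sum_antidiagonal_succ]
      simp only [diff_succ_nil, diff_zero, Finset.sum_const_zero, add_zero]
  | cons ξ l ih =>
    -- The entry `ξ` is kept by both maps, removed by the inner one, or removed by the outer one. In
    -- the last case `u ξ` is moved inside by anticommutation; its sign makes `(-1)^k` a common
    -- factor.
    have step : ∀ i ∈ Finset.HasAntidiagonal.antidiagonal k, diff u i.1 (diff w i.2 F) (ξ :: l) =
        (-1 : K) ^ k • (diff u i.1 (diff w i.2 (ins ξ F)) l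
          - diff u i.1 (diffPred w i.2 (coef (w ξ) F)) l
          - diffPred u i.1 (diff w i.2 (coef (u ξ) F)) l) := by
      intro i hi
      rw [← Finset.HasAntidiagonal.mem_antidiagonal.1 hi, diff_cons, ins_diff,
        coef_diff (fun η n => huw ξ η n)]
      simp only [map_smul, map_sub, Pi.smul_apply, Pi.sub_apply, pow_add]
      module
    rw [Finset.sum_congr rfl step, ← Finset.smul_sum, Finset.sum_sub_distrib,
      Finset.sum_sub_distrib, ih, diff_cons]
    congr 1
    rw [sub_sub]
    congr 1
    have hc : coef (u ξ + w ξ) F = coef (w ξ) F + coef (u ξ) F := by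
      ext m; simp [coef_apply, add_comm]
    cases k with
    | zero => simp [diffPred]
    | succ k =>
      have e1 := congrFun (sum_diff_diffPred u w k (coef (w ξ) F)) l
      have e2 := congrFun (sum_diffPred_diff u w k (coef (u ξ) F)) l
      rw [Finset.sum_apply, Finset.sum_apply] at e1 e2
      rw [e1, e2, ih, ih, hc]
      simp only [diffPred, map_add, Pi.add_apply]

theorem diff_one_nil (u : L → Module.End K N) (F : List L → N) : diff u 1 F [] = 0 := rfl

theorem diff_one_cons (u : L → Module.End K N) (F : List L → N) (ξ : L) (l : List L) :
    diff u 1 F (ξ :: l) = u ξ (F l) - diff u 1 (ins ξ F) l := by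
  rw [diff_cons]; simp [diffPred, diff_zero, coef_apply]

theorem ins_diff_one (u : L → Module.End K N) (F : List L → N) (ξ : L) :
    ins ξ (diff u 1 F) = coef (u ξ) F - diff u 1 (ins ξ F) :=
  funext fun _ => diff_one_cons ..

/-- The difference maps are derivations for the action of `A - der f`. -/
theorem lie_diff {A : Module.End K N} {f : L → L} {u w : L → Module.End K N}
    (hA : ∀ η n, A (u η n) - u η (A n) - u (f η) n = w η n)
    (hw : ∀ ξ η n, u ξ (w η n) = - w η (u ξ n)) (k : ℕ) (F : List L → N) (l : List L) :
    A (diff u k F l) - der K f (diff u k F) l - diff u k (coef A F) l + diff u k (der K f F) l =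
      diffPred u k (diff w 1 F) l := by
  induction l generalizing F k with
  | nil =>
    cases k with
    | zero => simp [diff_zero, diffPred, coef_apply, der_nil]
    | succ k =>
      cases k with
      | zero => simp [diff_succ_nil, der_nil, diffPred, diff_zero]
      | succ k => simp [diff_succ_nil, der_nil, diffPred]
  | cons η l ih =>
    cases k with
    | zero => simp [diff_zero, diffPred, coef_apply]
    | succ j =>
      have h1 := ih (j + 1) (ins η F)
      have h2 := ih j (coef (u η) F)
      -- The hypothesis `hA` moves `A` out of `u η`. The extra terms are the action of `f` on the
      -- removed entry and the contribution of `w` at `η`.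
      have hc : coef (u η) (coef A F) =
          coef A (coef (u η) F) - coef (u (f η)) F - coef (w η) F := by
        ext m
        simp only [coef_apply, Pi.sub_apply, ← hA]
        abel
      have h3 : coef (u η) (diff w 1 F) = -diff w 1 (coef (u η) F) := by
        rw [coef_diff (fun ξ n => hw η ξ n)]; simp
      rw [diffPred_succ] at h1 ⊢
      simp only [diff_cons u, der_cons, ins_coef, ins_der, ins_diff u, ins_diff_one w, coef_der,
        hc, h3, diffPred_succ, map_smul, map_sub, map_add, map_neg, Pi.smul_apply, Pi.sub_apply,
        Pi.add_apply,
        Pi.neg_apply] at h1 h2 ⊢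
      linear_combination (norm := module) (-1 : K) ^ (j + 1) • h1 - (-1 : K) ^ (j + 1) • h2

/-- The commutator of the Chevalley-Eilenberg differential with an endomorphism of the
coefficients. -/
theorem ce_coef [Bracket L L] {A : Module.End K N} {ρ w : L → Module.End K N}
    (hw : ∀ ξ n, ρ ξ (A n) - A (ρ ξ n) = w ξ n) (F : List L → N) :
    ce ρ (coef A F) = coef A (ce ρ F) + diff w 1 F := by
  ext l
  induction l generalizing F with
  | nil => simp [ce_nil, coef_apply, diff_succ_nil]
  | cons ξ l ih =>
    have h1 := ih (ins ξ F)
    have h2 := congrFun (coef_der A (fun η => ⁅ξ, η⁆) F) l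
    simp only [Pi.add_apply, coef_apply, ce_cons, ins_coef, diff_one_cons, ← h2, map_sub, h1,
      ← hw]
    abel

end Commutation

end ListCochain

namespace ListCochain

variable {K : Type*} [Field K] {L L' N : Type*} [AddCommGroup N] [Module K N]

/-! ### Naturality in the arguments -/

section Pull

theorem der_pull (f : L → L') {D : L → L} {D' : L' → L'} (hf : ∀ ξ, f (D ξ) = D' (f ξ))
    (F : List L' → N) : der K D (pull K f F) = pull K f (der K D' F) := by
  ext l
  induction l generalizing F with
  | nil => rfl
  | cons ξ l ih =>
    have := ih (ins (f ξ) F)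
    simp only [pull_apply, der_cons, List.map_cons, ins_pull, hf] at *
    rw [this]

theorem diff_pull_apply (f : L → L') (u : L' → Module.End K N) (k : ℕ) (F : List L' → N)
    (l : List L) : diff (fun ξ => u (f ξ)) k (pull K f F) l = diff u k F (l.map f) := by
  induction l generalizing F k with
  | nil => cases k <;> rfl
  | cons ξ l ih =>
    rw [List.map_cons, diff_cons, diff_cons, ins_pull, coef_pull, ih]
    cases k with
    | zero => rfl
    | succ k => rw [diffPred_succ, diffPred_succ, ih]

theorem diff_pull (f : L → L') (u : L' → Module.End K N) (k : ℕ) (F : List L' → N) :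
    diff (fun ξ => u (f ξ)) k (pull K f F) = pull K f (diff u k F) :=
  funext fun l => diff_pull_apply f u k F l

theorem ce_pull [Bracket L L] [Bracket L' L'] {f : L → L'} (hf : ∀ ξ η, f ⁅ξ, η⁆ = ⁅f ξ, f η⁆)
    (ρ : L' → Module.End K N) (F : List L' → N) :
    ce (fun ξ => ρ (f ξ)) (pull K f F) = pull K f (ce ρ F) := by
  ext l
  induction l generalizing F with
  | nil => rfl
  | cons ξ l ih =>
    have h := congrFun (der_pull (K := K) f (D := fun η => ⁅ξ, η⁆) (D' := fun η => ⁅f ξ, η⁆)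
      (hf ξ) F) l
    rw [pull_apply] at h
    rw [pull_apply, List.map_cons, ce_cons, ce_cons, ins_pull, ih, h]
    rfl

theorem pull_pull {L'' : Type*} (f : L → L') (f' : L' → L'') (F : List L'' → N) :
    pull K f (pull K f' F) = pull K (fun ξ => f' (f ξ)) F := by
  ext l; simp [pull_apply, Function.comp_def]

end Pull

/-! ### The square of the Chevalley-Eilenberg differential -/

/-- The functions on lists that are additive in each argument. -/
def Additive [AddGroup L] (F : List L → N) : Prop :=
  ∀ (l₁ l₂ : List L) (a b : L), F (l₁ ++ (a - b) :: l₂) = F (l₁ ++ a :: l₂) - F (l₁ ++ b :: l₂)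

theorem Additive.ins [AddGroup L] {F : List L → N} (hF : Additive F) (ξ : L) :
    Additive (ListCochain.ins ξ F) := fun l₁ l₂ a b => hF (ξ :: l₁) l₂ a b

section Square

variable [LieRing L] {ρ : L → Module.End K N}

/-- Terms acting on two different slots cancel, and within one slot the difference is the Jacobi
identity; additivity is needed to combine the two values. The minus sign appears because
precomposition reverses the order. -/
theorem der_lie_apply {F : List L → N} (hF : Additive F) (ξ η : L) (l : List L) :
    der K (fun ζ => ⁅ξ, ζ⁆) (der K (fun ζ => ⁅η, ζ⁆) F) l
      - der K (fun ζ => ⁅η, ζ⁆) (der K (fun ζ => ⁅ξ, ζ⁆) F) l =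
        - der K (fun ζ => ⁅⁅ξ, η⁆, ζ⁆) F l := by
  induction l generalizing F with
  | nil => simp [der_nil]
  | cons ζ l ih =>
    have h1 := ih (hF.ins ζ)
    have h2 := hF [] l ⁅ξ, ⁅η, ζ⁆⁆ ⁅η, ⁅ξ, ζ⁆⁆
    have h3 : ⁅ξ, ⁅η, ζ⁆⁆ - ⁅η, ⁅ξ, ζ⁆⁆ = ⁅⁅ξ, η⁆, ζ⁆ := by rw [leibniz_lie ξ η ζ]; abel
    rw [h3] at h2
    simp only [List.nil_append] at h2
    simp only [der_cons, ins_der, map_add, Pi.add_apply, h2]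
    linear_combination (norm := module) h1

/-- Peeling off the first entry `η` leaves the same identity for `ins η F`; what remains cancels by
`hρ` and by the Jacobi identity in the form `der_lie_apply`. This is `[L_ξ, δ] = 0`. -/
theorem lie_ce (hρ : ∀ ξ η n, ρ ⁅ξ, η⁆ n = ρ ξ (ρ η n) - ρ η (ρ ξ n)) {F : List L → N}
    (hF : Additive F) (ξ : L) (l : List L) :
    ρ ξ (ce ρ F l) - der K (fun ζ => ⁅ξ, ζ⁆) (ce ρ F) l - ce ρ (coef (ρ ξ) F) l
      + ce ρ (der K (fun ζ => ⁅ξ, ζ⁆) F) l = 0 := by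
  induction l generalizing F with
  | nil => simp [ce_nil, der_nil]
  | cons η l ih =>
    have h1 := ih (hF.ins η)
    have h2 := der_lie_apply (K := K) hF ξ η l
    have h3 := hρ ξ η (F l)
    have h4 := congrFun (coef_der (ρ ξ) (fun ζ => ⁅η, ζ⁆) F) l
    have h5 := congrFun (coef_der (ρ η) (fun ζ => ⁅ξ, ζ⁆) F) l
    rw [coef_apply] at h4 h5
    simp only [ce_cons, der_cons, ins_ce, ins_coef, ins_der, map_sub, map_add, Pi.sub_apply,
      Pi.add_apply, coef_apply, h4, h5] at h1 ⊢
    linear_combination (norm := module) - h1 + h2 - h3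

/-- From `ι_ξ δ = L_ξ - δ ι_ξ` one gets `ι_ξ δ² = [L_ξ, δ] + δ² ι_ξ`, and the induction hypothesis
applies to `ι_ξ F`. -/
theorem ce_ce_apply (hρ : ∀ ξ η n, ρ ⁅ξ, η⁆ n = ρ ξ (ρ η n) - ρ η (ρ ξ n)) {F : List L → N}
    (hF : Additive F) (l : List L) : ce ρ (ce ρ F) l = 0 := by
  induction l generalizing F with
  | nil => rfl
  | cons ξ l ih =>
    have h1 := ih (hF.ins ξ)
    have h2 := lie_ce hρ hF ξ l
    rw [ce_cons, ins_ce]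
    simp only [map_sub, Pi.sub_apply, h1]
    linear_combination (norm := module) h2

end Square

/-- The compatibility of the difference maps with the Chevalley-Eilenberg differentials and a
differential `d` of the coefficients for which `u` provides homotopies. -/
theorem ce_diff_apply [LieRing L] {u ρ₀ ρ₁ : L → Module.End K N} {w : L → L → Module.End K N}
    {d : Module.End K N}
    (hd : ∀ ξ n, u ξ (d n) + d (u ξ n) = ρ₀ ξ n - ρ₁ ξ n)
    (h₀ : ∀ ξ η n, ρ₀ ξ (u η n) - u η (ρ₀ ξ n) - u ⁅ξ, η⁆ n = w ξ η n)
    (h₁ : ∀ ξ η n, ρ₁ η (u ξ n) - u ξ (ρ₁ η n) = w ξ η n)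
    (hw : ∀ ξ η ζ n, u η (w ξ ζ n) = - w ξ ζ (u η n)) (k : ℕ) (F : List L → N) (l : List L) :
    ce ρ₀ (diff u k F) l + (-1 : K) ^ (k + 1) • diff u k (ce ρ₁ F) l =
      d (diff u (k + 1) F l) + (-1 : K) ^ k • diff u (k + 1) (coef d F) l := by
  induction l generalizing F k with
  | nil => cases k <;> simp [ce_nil, diff_succ_nil, diff_zero]
  | cons ξ l ih =>
    have h2 := lie_diff (h₀ ξ) (fun η ζ => hw ξ η ζ) k F l
    have h3 := ih k (ins ξ F)
    -- The homotopy formula `hd`: it exchanges `ρ₁` for `ρ₀` on the removed entry.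
    have hcd : coef (u ξ) (coef d F) = coef (ρ₀ ξ) F - coef (ρ₁ ξ) F - coef d (coef (u ξ) F) := by
      ext m
      simp only [coef_apply, Pi.sub_apply, ← hd]
      abel
    -- The term in `w ξ` cancels the right-hand side of `h2`; this is why `h₀` and `h₁` must have
    -- the same defect `w`.
    have hcc : coef (u ξ) (ce ρ₁ F) = ce ρ₁ (coef (u ξ) F) - diff (w ξ) 1 F := by
      rw [ce_coef (fun η n => h₁ ξ η n)]; abel
    cases k with
    | zero =>
      simp only [ce_cons, diff_zero, zero_add, diff_one_cons, pow_zero, pow_one, ins_coef,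
        map_sub, diffPred, LinearMap.zero_apply, Pi.zero_apply, coef_apply] at h2 h3 ⊢
      linear_combination (norm := module) - hd ξ (F l) - h3
    | succ j =>
      have h4 := ih j (coef (u ξ) F)
      rw [diffPred_succ] at h2
      simp only [ce_cons, ins_ce, diff_cons u, ins_diff u, ins_coef, hcd, hcc, diffPred_succ,
        map_sub, map_smul, Pi.sub_apply, Pi.smul_apply] at h2 h3 h4 ⊢
      -- Fixing the parity of `j` makes all signs numerical, so that the combination is linear.
      rcases neg_one_pow_eq_or K j with h | h <;> simp only [pow_succ, h] at h3 h4 ⊢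
      · linear_combination (norm := module) h2 + h3 - h4
      · linear_combination (norm := module) h2 - h3 + h4

end ListCochain

namespace ListCochain

variable {K : Type*} [Field K] {L L' N : Type*} [AddCommGroup N] [Module K N]

/-! ### Supports in a single length -/

section Support

theorem eq_of_forall_ofFn {n : ℕ} {F G : List L → N} (hF : ∀ l, l.length ≠ n → F l = 0)
    (hG : ∀ l, l.length ≠ n → G l = 0) (h : ∀ v : Fin n → L, F (List.ofFn v) = G (List.ofFn v)) :
    F = G := by
  ext l
  by_cases hl : l.length = n
  · subst hl
    have := h l.get
    rwa [List.ofFn_get] at this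
  · rw [hF l hl, hG l hl]

theorem der_eq_zero {f : L → L} {F : List L → N} {l : List L}
    (h : ∀ m, m.length = l.length → F m = 0) : der K f F l = 0 := by
  induction l generalizing F with
  | nil => rfl
  | cons η l ih =>
    rw [der_cons, h (f η :: l) rfl, ih (F := ins η F) fun m hm => h _ (by simp [hm]), add_zero]

theorem diff_eq_zero {u : L → Module.End K N} {k : ℕ} {F : List L → N} {l : List L}
    (h : ∀ m, m.length + k = l.length → F m = 0) : diff u k F l = 0 := by
  induction l generalizing F k with
  | nil =>
    cases k with
    | zero => exact h [] rfl
    | succ k => rfl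
  | cons ξ l ih =>
    rw [diff_cons, ih (F := ins ξ F) fun m hm => h _ (by simp only [List.length_cons]; omega)]
    cases k with
    | zero => simp [diffPred]
    | succ k =>
      rw [diffPred_succ, ih (F := coef (u ξ) F) fun m hm => by
        rw [coef_apply, h m (by simp only [List.length_cons]; omega), map_zero]]
      simp

theorem ce_eq_zero [Bracket L L] {ρ : L → Module.End K N} {F : List L → N} {l : List L}
    (h : ∀ m, m.length + 1 = l.length → F m = 0) : ce ρ F l = 0 := by
  induction l generalizing F with
  | nil => rfl
  | cons ξ l ih =>
    rw [ce_cons, h l rfl, der_eq_zero fun m hm => h m (by simp [hm]),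
      ih (F := ins ξ F) fun m hm => h _ (by simp only [List.length_cons]; omega)]
    simp

end Support

/-! ### Sums over subsets as recursions on lists -/

section Shuffle

/-- The shuffle sum `∑_a (-1)^(a₁ + ⋯ + a_k) G(ξ_{a₁}, …, ξ_{a_k})(…)` on lists, by recursion. -/
def shuffleList (K : Type*) [Field K] {L N : Type*} [AddCommGroup N] [Module K N] :
    ℕ → (List L → List L → N) → List L → N
  | 0, G, l => G [] l
  | _ + 1, _, [] => 0
  | k + 1, G, ξ :: l => (-1 : K) ^ k • shuffleList K k (fun a b => G (ξ :: a) b) l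
      + (-1 : K) ^ (k + 1) • shuffleList K (k + 1) (fun a b => G a (ξ :: b)) l

theorem shuffleList_zero (G : List L → List L → N) (l : List L) :
    shuffleList K 0 G l = G [] l := by cases l <;> rfl

theorem shuffleList_succ_cons (k : ℕ) (G : List L → List L → N) (ξ : L) (l : List L) :
    shuffleList K (k + 1) G (ξ :: l) =
      (-1 : K) ^ k • shuffleList K k (fun a b => G (ξ :: a) b) l
      + (-1 : K) ^ (k + 1) • shuffleList K (k + 1) (fun a b => G a (ξ :: b)) l := rfl

theorem shuffleList_neg (k : ℕ) (G : List L → List L → N) (l : List L) :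
    shuffleList K k (fun a b => - G a b) l = - shuffleList K k G l := by
  induction l generalizing k G with
  | nil =>
    cases k
    · rfl
    · exact neg_zero.symm
  | cons ξ l ih =>
    cases k with
    | zero => rfl
    | succ k =>
      rw [shuffleList_succ_cons, shuffleList_succ_cons, ih, ih]
      module

/-- A left fold lets the removed entry of smallest index act first, which is the order in which the
recursion for `diff` composes the operators. -/
theorem diff_eq_shuffleList (u : L → Module.End K N) (k : ℕ) (F : List L → N) (l : List L) :
    diff u k F l = shuffleList K k (fun a b => a.foldl (fun n ξ => u ξ n) (F b)) l := by
  induction l generalizing k F with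
  | nil => cases k <;> rfl
  | cons ξ l ih =>
    cases k with
    | zero => rfl
    | succ k =>
      have h1 := ih k (coef (u ξ) F)
      have h2 := ih (k + 1) (ins ξ F)
      rw [diff_cons, shuffleList_succ_cons, diffPred_succ, h1, h2]
      simp only [List.foldl_cons, coef_apply, ins_apply]
      module

/-- The subsets are split according to whether they contain `0`. The remaining elements are shifted
by one, each changing the sign once: `k` of them in the first case and `k + 1` in the second. -/
theorem sum_powersetCard (n k : ℕ) (v : Fin n → L) (G : List L → List L → N) :
    ∑ a ∈ (Finset.univ : Finset (Fin n)).powersetCard k, (-1 : K) ^ (∑ i ∈ a, (i : ℕ)) •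
      G (((List.finRange n).filter (· ∈ a)).map v) (((List.finRange n).filter (· ∉ a)).map v) =
    shuffleList K k G (List.ofFn v) := by
  induction n generalizing k G with
  | zero =>
    cases k with
    | zero => simp [shuffleList_zero]
    | succ k =>
      rw [Finset.powersetCard_eq_empty.2 (by simp)]
      rfl
  | succ n ih =>
    cases k with
    | zero => simp [shuffleList_zero, List.ofFn_succ, List.ofFn_eq_map, List.finRange_succ,
      Function.comp_def]
    | succ k =>
      have hsum : ∀ b : Finset (Fin n), (-1 : K) ^ (∑ i ∈ b.map (Fin.succEmb n), (i : ℕ)) =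
          (-1) ^ b.card * (-1) ^ ∑ i ∈ b, (i : ℕ) := fun b => by
        simp [Finset.sum_add_distrib, pow_add, mul_comm]
      have h0 : ∀ b : Finset (Fin n), (0 : Fin (n + 1)) ∉ b.map (Fin.succEmb n) := fun b => by
        simp [Fin.succ_ne_zero]
      have hu : (Finset.univ : Finset (Fin (n + 1))) =
          insert 0 ((Finset.univ : Finset (Fin n)).map (Fin.succEmb n)) := by
        ext i
        refine Fin.cases ?_ (fun i => ?_) i <;> simp
      rw [hu, Finset.powersetCard_succ_insert (h0 _), Finset.sum_union, Finset.sum_image,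
        Finset.powersetCard_map, Finset.powersetCard_map, Finset.sum_map, Finset.sum_map,
        List.ofFn_succ, shuffleList_succ_cons, ← ih, ← ih, Finset.smul_sum, Finset.smul_sum,
        add_comm]
      · congr 1
        · refine Finset.sum_congr rfl fun b hb => ?_
          rw [RelEmbedding.coe_toEmbedding, Finset.mapEmbedding_apply,
            Finset.sum_insert (h0 b), Fin.val_zero, zero_add, hsum,
            (Finset.mem_powersetCard.1 hb).2, mul_smul, List.finRange_succ]
          simp [List.filter_map, Function.comp_def, Fin.succ_ne_zero]
        · refine Finset.sum_congr rfl fun b hb => ?_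
          rw [RelEmbedding.coe_toEmbedding, Finset.mapEmbedding_apply, hsum,
            (Finset.mem_powersetCard.1 hb).2, mul_smul, List.finRange_succ]
          simp [List.filter_map, Function.comp_def, Fin.succ_ne_zero]
      · intro a ha b hb hab
        have ha0 : (0 : Fin (n + 1)) ∉ a := fun h => h0 _ ((Finset.mem_powersetCard.1 ha).1 h)
        have hb0 : (0 : Fin (n + 1)) ∉ b := fun h => h0 _ ((Finset.mem_powersetCard.1 hb).1 h)
        rw [← Finset.erase_insert ha0, ← Finset.erase_insert hb0]
        exact congrArg (Finset.erase · 0) hab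
      · rw [Finset.disjoint_left]
        intro a ha hb
        obtain ⟨b, -, rfl⟩ := Finset.mem_image.1 hb
        exact h0 _ ((Finset.mem_powersetCard.1 ha).1 (Finset.mem_insert_self _ _))

theorem ofFn_orderEmbOfFin {n k : ℕ} (a : Finset (Fin n)) (h : a.card = k) :
    List.ofFn (a.orderEmbOfFin h) = (List.finRange n).filter (· ∈ a) := by
  refine List.SortedLT.eq_of_mem_iff ?_ ?_ fun i => ?_
  · exact List.sortedLT_ofFn_iff.2 (a.orderEmbOfFin h).strictMono
  · exact ((List.sortedLT_finRange n).pairwise.filter _).sortedLT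
  · rw [List.mem_ofFn', Finset.range_orderEmbOfFin]
    simp

theorem sum_sub {q k : ℕ} (v : Fin (q + k) → L) (G : List L → List L → N) :
    ∑ a : Sub q k, a.sign K • G (List.ofFn (v ∘ a.sel)) (List.ofFn (v ∘ a.cosel)) =
      shuffleList K k G (List.ofFn v) := by
  rw [← sum_powersetCard]
  rw [Finset.sum_subtype (p := fun a : Finset (Fin (q + k)) => a.card = k) _
    fun a => by simp [Finset.mem_powersetCard]]
  refine Finset.sum_congr rfl fun a _ => ?_
  rw [Sub.sign, ← List.map_ofFn, ← List.map_ofFn]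
  congr 3
  · exact ofFn_orderEmbOfFin _ _
  · have := ofFn_orderEmbOfFin a.1ᶜ a.card_compl
    simp only [Finset.mem_compl] at this
    exact this

end Shuffle

end ListCochain

namespace ListCochain

variable {K : Type*} [Field K] {L N : Type*} [AddCommGroup N] [Module K N]

/-! ### Antisymmetric cochains and the shuffle form of the differential -/

section Antisymmetric

/-- The functions on lists that change sign when two neighbouring arguments are exchanged. -/
def Antisymm (F : List L → N) : Prop :=
  ∀ (l₁ l₂ : List L) (x y : L), F (l₁ ++ x :: y :: l₂) = - F (l₁ ++ y :: x :: l₂)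

theorem Antisymm.ins {F : List L → N} (hF : Antisymm F) (ξ : L) :
    Antisymm (ListCochain.ins ξ F) := fun l₁ l₂ x y => hF (ξ :: l₁) l₂ x y

/-- `(y, b) ↦ F(D y, b)`. -/
def firstSlot (D : L → L) (F : List L → N) : List L → List L → N
  | [y], b => F (D y :: b)
  | _, _ => 0

/-- Moving the modified entry from the first slot back to its own position costs as many
transpositions as its index, which is the sign in the shuffle sum. -/
theorem shuffleList_firstSlot (D : L → L) {F : List L → N} (hF : Antisymm F) (l : List L) :
    shuffleList K 1 (firstSlot D F) l = der K D F l := by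
  induction l generalizing F with
  | nil => rfl
  | cons η l ih =>
    have h : (fun a b => firstSlot D F a (η :: b)) = fun a b => - firstSlot D (ins η F) a b := by
      ext a b
      rcases a with _ | ⟨y, _ | ⟨z, a⟩⟩
      · exact neg_zero.symm
      · exact hF [] b (D y) η
      · exact neg_zero.symm
    rw [shuffleList_succ_cons, der_cons, h, shuffleList_neg, ih (hF.ins η), shuffleList_zero]
    simp [firstSlot]

/-- `(x, y, b) ↦ F([x, y], b)`. -/
def bracketSlot [Bracket L L] (F : List L → N) : List L → List L → N
  | [x, y], b => F (⁅x, y⁆ :: b)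
  | _, _ => 0

/-- Pairs of indices containing `0` give the derivation term of the recursion. The other pairs give
the bracket sum of `ins ξ F`, after antisymmetry has carried the bracket past `ξ`. -/
theorem ce_eq [Bracket L L] (ρ : L → Module.End K N) {F : List L → N} (hF : Antisymm F)
    (l : List L) : ce ρ F l = diff ρ 1 F l + shuffleList K 2 (bracketSlot F) l := by
  induction l generalizing F with
  | nil => simp [ce_nil, diff_one_nil, shuffleList]
  | cons ξ l ih =>
    have h1 : (fun a b => bracketSlot F (ξ :: a) b) = firstSlot (fun η => ⁅ξ, η⁆) F := by
      ext a b
      rcases a with _ | ⟨y, _ | ⟨z, a⟩⟩ <;> rfl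
    have h2 : (fun a b => bracketSlot F a (ξ :: b)) = fun a b => - bracketSlot (ins ξ F) a b := by
      ext a b
      rcases a with _ | ⟨y, _ | ⟨z, _ | ⟨t, a⟩⟩⟩
      · exact neg_zero.symm
      · exact neg_zero.symm
      · exact hF [] b ⁅y, z⁆ ξ
      · exact neg_zero.symm
    rw [ce_cons, ih (hF.ins ξ), diff_one_cons, shuffleList_succ_cons, h1, h2, shuffleList_neg,
      shuffleList_firstSlot _ hF]
    module

end Antisymmetric

/-! ### Evaluation on tuples -/

section OfFn

theorem der_ofFn (D : L → L) {n : ℕ} (F : List L → N) (v : Fin n → L) :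
    der K D F (List.ofFn v) = ∑ k, F (List.ofFn (Function.update v k (D (v k)))) := by
  induction n generalizing F with
  | zero => rw [List.ofFn_zero]; simp [der_nil]
  | succ n ih =>
    rw [List.ofFn_succ, der_cons, ih, Fin.sum_univ_succ]
    congr 1
    · rw [List.ofFn_succ]
      simp [Fin.succ_ne_zero]
    · refine Finset.sum_congr rfl fun k _ => ?_
      rw [List.ofFn_succ, ins_apply, Function.update_of_ne (Fin.succ_ne_zero k).symm]
      congr 3
      ext i
      simp [Function.update_apply]

theorem diff_one_ofFn (u : L → Module.End K N) {n : ℕ} (F : List L → N) (v : Fin (n + 1) → L) :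
    diff u 1 F (List.ofFn v) =
      ∑ j : Fin (n + 1), (-1 : ℤ) ^ (j : ℕ) • u (v j) (F (List.ofFn (Fin.removeNth j v))) := by
  induction n generalizing F with
  | zero =>
    rw [List.ofFn_succ, diff_one_cons]
    simp [diff_one_nil]
  | succ n ih =>
    rw [List.ofFn_succ, diff_one_cons, ih, Fin.sum_univ_succ (n := n + 1), sub_eq_add_neg,
      ← Finset.sum_neg_distrib]
    congr 1
    · simp [Fin.removeNth_zero, Fin.tail_def]
    · refine Finset.sum_congr rfl fun j _ => ?_
      rw [Fin.val_succ, pow_succ, mul_neg_one, neg_smul]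
      congr 4
      rw [List.ofFn_succ]
      simp only [Fin.removeNth, Fin.succ_succAbove_zero, Fin.succ_succAbove_succ]
      rfl

end OfFn

/-! ### Alternating maps as functions on lists -/

section ToList

variable [AddCommGroup L] [Module K L] {M : Type*} [AddCommGroup M] [Module K M]

/-- An alternating map as a function on lists, with the values moved along a linear map. -/
def toList (j : M →ₗ[K] N) (q : ℕ) : (L [⋀^Fin q]→ₗ[K] M) →ₗ[K] (List L → N) where
  toFun ω l := if h : l.length = q then j (ω fun i => l.get (i.cast h.symm)) else 0
  map_add' ω η := by ext l; by_cases h : l.length = q <;> simp [h]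
  map_smul' t ω := by ext l; by_cases h : l.length = q <;> simp [h]

theorem toList_of_length {j : M →ₗ[K] N} {q : ℕ} (ω : L [⋀^Fin q]→ₗ[K] M) {l : List L}
    (h : l.length = q) : toList j q ω l = j (ω fun i => l.get (i.cast h.symm)) := dif_pos h

theorem toList_eq_zero {j : M →ₗ[K] N} {q : ℕ} (ω : L [⋀^Fin q]→ₗ[K] M) {l : List L}
    (h : l.length ≠ q) : toList j q ω l = 0 := dif_neg h

theorem toList_ofFn (j : M →ₗ[K] N) {q : ℕ} (ω : L [⋀^Fin q]→ₗ[K] M) (v : Fin q → L) :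
    toList j q ω (List.ofFn v) = j (ω v) := by
  rw [toList_of_length ω (List.length_ofFn)]
  congr 2
  ext i
  simp

theorem toList_curryLeft (j : M →ₗ[K] N) {q : ℕ} (ω : L [⋀^Fin (q + 1)]→ₗ[K] M) (ξ : L) :
    toList j q (ω.curryLeft ξ) = ins ξ (toList j (q + 1) ω) := by
  refine eq_of_forall_ofFn (fun l h => toList_eq_zero _ h)
    (fun l h => toList_eq_zero _ (by simpa using h)) fun v => ?_
  have : ξ :: List.ofFn v = List.ofFn (Matrix.vecCons ξ v) := by simp [List.ofFn_succ]
  rw [ins_apply, this, toList_ofFn, toList_ofFn]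
  rfl

theorem toList_additive (j : M →ₗ[K] N) {q : ℕ} (ω : L [⋀^Fin q]→ₗ[K] M) :
    Additive (toList j q ω) := by
  intro l₁ l₂ a b
  by_cases h : (l₁ ++ a :: l₂).length = q
  · have hl : ∀ z, (l₁ ++ z :: l₂).length = q := fun z => by simpa using h
    have hi : l₁.length < q := by rw [← h]; simp
    have key : ∀ z, (fun i : Fin q => (l₁ ++ z :: l₂).get (i.cast (hl z).symm)) =
        Function.update (fun i : Fin q => (l₁ ++ a :: l₂).get (i.cast h.symm))
          ⟨l₁.length, hi⟩ z := by
      intro z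
      ext ⟨i, hi⟩
      simp only [Function.update_apply, Fin.mk.injEq, List.get_eq_getElem, Fin.val_cast,
        List.getElem_append, List.getElem_cons]
      split_ifs <;> first | rfl | omega
    rw [toList_of_length ω (hl _), toList_of_length ω (hl _), toList_of_length ω (hl _),
      key (a - b), key b, ω.map_update_sub, map_sub, ← key a]
  · have hl : ∀ z, (l₁ ++ z :: l₂).length ≠ q := fun z => by simpa using h
    rw [toList_eq_zero ω (hl _), toList_eq_zero ω (hl _), toList_eq_zero ω (hl _), sub_zero]

theorem toList_antisymm (j : M →ₗ[K] N) {q : ℕ} (ω : L [⋀^Fin q]→ₗ[K] M) :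
    Antisymm (toList j q ω) := by
  intro l₁ l₂ x y
  by_cases h : (l₁ ++ x :: y :: l₂).length = q
  · have h' : (l₁ ++ y :: x :: l₂).length = q := by simpa using h
    have hi : l₁.length < q := by rw [← h]; simp
    have hj : l₁.length + 1 < q := by rw [← h]; simp
    have hij : (⟨l₁.length, hi⟩ : Fin q) ≠ ⟨l₁.length + 1, hj⟩ := by simp
    have key : (fun i : Fin q => (l₁ ++ x :: y :: l₂).get (i.cast h.symm)) =
        (fun i : Fin q => (l₁ ++ y :: x :: l₂).get (i.cast h'.symm)) ∘
          Equiv.swap ⟨l₁.length, hi⟩ ⟨l₁.length + 1, hj⟩ := by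
      ext i
      rw [Function.comp_apply, Equiv.swap_apply_def]
      split_ifs with h1 h2
      · subst h1; simp
      · subst h2; simp
      · simp only [Fin.ext_iff] at h1 h2
        simp only [List.get_eq_getElem, Fin.val_cast, List.getElem_append, List.getElem_cons]
        split_ifs <;> first | rfl | omega
    rw [toList_of_length ω h, toList_of_length ω h', key, ω.map_swap _ hij, map_neg]
  · rw [toList_eq_zero ω h, toList_eq_zero ω (by simpa using h), neg_zero]

theorem toList_shuffle_ofFn (j : M →ₗ[K] N) {k q : ℕ} (F : L [⋀^Fin k]→ₗ[K] (L [⋀^Fin q]→ₗ[K] M))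
    {G : List L → List L → N} (h : ∀ v w, G (List.ofFn v) (List.ofFn w) = j (F v w))
    (v : Fin (q + k) → L) :
    toList j (q + k) (shuffle F) (List.ofFn v) = shuffleList K k G (List.ofFn v) := by
  rw [toList_ofFn, shuffle_apply, ← sum_sub, map_sum]
  refine Finset.sum_congr rfl fun a _ => ?_
  rw [map_smul, h]

theorem toList_pullback {L' : Type*} [AddCommGroup L'] [Module K L'] (j : M →ₗ[K] N) {q : ℕ}
    (f : L →ₗ[K] L') (ω : L' [⋀^Fin q]→ₗ[K] M) :
    toList j q (pullback f ω) = pull K f (toList j q ω) := by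
  refine eq_of_forall_ofFn (fun l h => toList_eq_zero _ h)
    (fun l h => toList_eq_zero _ (by simpa using h)) fun v => ?_
  rw [pull_apply, List.map_ofFn, toList_ofFn, toList_ofFn]
  rfl

theorem toList_compAlternatingMap {M' : Type*} [AddCommGroup M'] [Module K M'] {j : M →ₗ[K] N}
    {j' : M' →ₗ[K] N} {A : Module.End K N} {f : M →ₗ[K] M'} (h : ∀ m, j' (f m) = A (j m)) (q : ℕ)
    (ω : L [⋀^Fin q]→ₗ[K] M) :
    toList j' q (f.compAlternatingMap ω) = coef A (toList j q ω) := by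
  refine eq_of_forall_ofFn (fun l h => toList_eq_zero _ h)
    (fun l h => by rw [coef_apply, toList_eq_zero _ h, map_zero]) fun v => ?_
  rw [coef_apply, toList_ofFn, toList_ofFn, ← h]
  rfl

end ToList

/-! ### The Chevalley-Eilenberg differential on lists -/

section ChevalleyEilenberg

variable [LieRing L] [LieAlgebra K L] {M : Type*} [AddCommGroup M] [Module K M]

/-- The two summands of `ceDiff` match those of `ce_eq`: the action terms are a difference map of
degree one and the bracket terms are a shuffle over pairs. -/
theorem toList_ceDiff {j : M →ₗ[K] N} {ρ : L →ₗ[K] Module.End K M} {ρ' : L → Module.End K N}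
    (h : ∀ x m, j (ρ x m) = ρ' x (j m)) (q : ℕ) (ω : L [⋀^Fin q]→ₗ[K] M) :
    toList j (q + 1) (ceDiff ρ q ω) = ce ρ' (toList j q ω) := by
  refine eq_of_forall_ofFn (n := q + 1) (fun l hl => toList_eq_zero _ hl)
    (fun l hl => ce_eq_zero fun m hm => toList_eq_zero _ (by omega)) fun v => ?_
  rw [ce_eq _ (toList_antisymm j ω), diff_one_ofFn, ceDiff, LinearMap.add_apply, map_add,
    Pi.add_apply]
  congr 1
  · rw [toList_ofFn]
    change j (AlternatingMap.alternatizeUncurryFin _ v) = _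
    rw [AlternatingMap.alternatizeUncurryFin_apply, map_sum]
    refine Finset.sum_congr rfl fun i _ => ?_
    rw [map_zsmul, toList_ofFn, ← h]
    rfl
  · cases q with
    | zero =>
      -- In degree `0` there is no bracket term: a list with one entry contains no pairs.
      rw [List.ofFn_succ, List.ofFn_zero]
      simp [ceBracket, shuffleList]
    | succ q =>
      refine toList_shuffle_ofFn j (k := 2) (q := q) (bracketContract ω) (fun x w => ?_) v
      rw [bracketContract_apply, ← toList_ofFn]
      simp [List.ofFn_succ, bracketSlot]

/-- Cartan's formula. -/
theorem ceDiff_curryLeft {ρ : L →ₗ[K] Module.End K M} (q : ℕ) (ω : L [⋀^Fin (q + 1)]→ₗ[K] M) (x : L)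
    (v : Fin (q + 1) → L) :
    ceDiff ρ (q + 1) ω (Matrix.vecCons x v) =
      ρ x (ω v) - ∑ k, ω (Function.update v k ⁅x, v k⁆) - ceDiff ρ q (ω.curryLeft x) v := by
  have h := toList_ceDiff (j := LinearMap.id) (ρ := ρ) (ρ' := ρ) fun _ _ => rfl
  have h2 : ∀ {n : ℕ} (η : L [⋀^Fin n]→ₗ[K] M) v, η v = toList LinearMap.id n η (List.ofFn v) :=
    fun η v => (toList_ofFn LinearMap.id η v).symm
  have h3 : List.ofFn (Matrix.vecCons x v) = x :: List.ofFn v := by rw [List.ofFn_succ]; simp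
  rw [h2, h3, h, ce_cons, der_ofFn, ← toList_curryLeft, ← h]
  simp only [← h2]

end ChevalleyEilenberg

end ListCochain

section

open ListCochain

variable {K : Type*} [Field K] {g h W V : Type u} [LieRing g] [LieAlgebra K g]
  [LieRing h] [LieAlgebra K h] [AddCommGroup W] [Module K W] [AddCommGroup V] [Module K V]

/-! ### The equations of a 2-representation -/

section Rep

variable {X : CrossedModule K g h} {φ : W →ₗ[K] V} (ρ : TwoRep X φ)

theorem TwoRep.onW_lie (y z : h) (w : W) :
    ρ.onW ⁅y, z⁆ w = ρ.onW y (ρ.onW z w) - ρ.onW z (ρ.onW y w) := by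
  change (ρ.bot ⁅y, z⁆).1.1 w = _
  rw [LieHom.map_lie]; rfl

theorem TwoRep.onV_lie (y z : h) (v : V) :
    ρ.onV ⁅y, z⁆ v = ρ.onV y (ρ.onV z v) - ρ.onV z (ρ.onV y v) := by
  change (ρ.bot ⁅y, z⁆).1.2 v = _
  rw [LieHom.map_lie]; rfl

theorem TwoRep.map_onW (y : h) (w : W) : φ (ρ.onW y w) = ρ.onV y (φ w) :=
  GlZero.comm (ρ.bot y) w

/-- Compatibility of the morphism with the structure maps. This equation and the next one supply
Cartan's formula in coefficient degrees `1` and `0`, where the complex passes between `W` and `V`.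
-/
theorem TwoRep.onW_mu (x : g) (w : W) : ρ.onW (X.mu x) w = ρ.arrow x (φ w) := by
  change (ρ.bot (X.mu x)).1.1 w = _
  rw [ρ.comm]; rfl

theorem TwoRep.onV_mu (x : g) (v : V) : ρ.onV (X.mu x) v = φ (ρ.arrow x v) := by
  change (ρ.bot (X.mu x)).1.2 v = _
  rw [ρ.comm]; rfl

theorem TwoRep.arrow_act (y : h) (x : g) (v : V) :
    ρ.arrow (X.act y x) v = ρ.onW y (ρ.arrow x v) - ρ.arrow x (ρ.onV y v) := by
  change GlOne.toLin φ (ρ.top (X.act y x)) v = _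
  rw [ρ.map_act]; rfl

end Rep

/-! ### Cartan calculus in the coefficients -/

section Coefficients

variable {X : CrossedModule K g h} {φ : W →ₗ[K] V} (ρ : TwoRep X φ)

theorem hochRep_vecCons (r : ℕ) (y : h) (ω : g [⋀^Fin (r + 1)]→ₗ[K] W) (x : g) (v : Fin r → g) :
    hochRep ρ (r + 1) y ω (Matrix.vecCons x v) =
      hochRep ρ r y (ω.curryLeft x) v - ω (Matrix.vecCons (X.act y x) v) := by
  rw [hochRep_apply, hochRep_apply, Fin.sum_univ_succ]
  have h0 : Function.update (Matrix.vecCons x v) 0 (X.act y (Matrix.vecCons x v 0)) =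
      Matrix.vecCons (X.act y x) v := by
    ext i; refine Fin.cases ?_ (fun i => ?_) i <;> simp
  have hs : ∀ k : Fin r, ω (Function.update (Matrix.vecCons x v) k.succ
      (X.act y (Matrix.vecCons x v k.succ))) =
        ω.curryLeft x (Function.update v k (X.act y (v k))) := by
    intro k
    rw [AlternatingMap.curryLeft_apply_apply]
    congr 1
    ext i; refine Fin.cases ?_ (fun i => ?_) i <;>
      simp [Function.update_apply, (Fin.succ_ne_zero _).symm]
  rw [h0, Finset.sum_congr rfl fun k _ => hs k, AlternatingMap.curryLeft_apply_apply]
  abel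

theorem ext_vecCons {L M : Type*} [AddCommGroup L] [Module K L] [AddCommGroup M] [Module K M]
    {r : ℕ} {ω η : L [⋀^Fin (r + 1)]→ₗ[K] M}
    (h : ∀ x v, ω (Matrix.vecCons x v) = η (Matrix.vecCons x v)) : ω = η := by
  ext v
  have := h (v 0) (Fin.tail v)
  rwa [show Matrix.vecCons (v 0) (Fin.tail v) = v from Fin.cons_self_tail v] at this

theorem hochRep_curryLeft (r : ℕ) (y : h) (ω : g [⋀^Fin (r + 1)]→ₗ[K] W) (x : g) :
    (hochRep ρ (r + 1) y ω).curryLeft x =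
      hochRep ρ r y (ω.curryLeft x) - ω.curryLeft (X.act y x) :=
  AlternatingMap.ext fun v => hochRep_vecCons ρ r y ω x v

/-- Contraction with `x` lowers the degree; the correction terms from `[L_y, ι_x] = ι_{𝓛_y x}` match
because `X.act` respects brackets. -/
theorem hochRep_lie (r : ℕ) (y z : h) (ω : g [⋀^Fin r]→ₗ[K] W) :
    hochRep ρ r ⁅y, z⁆ ω = hochRep ρ r y (hochRep ρ r z ω) - hochRep ρ r z (hochRep ρ r y ω) := by
  induction r with
  | zero => ext v; simp [hochRep_apply, TwoRep.onW_lie]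
  | succ r ih =>
    refine ext_vecCons fun x v => ?_
    have h1 := congrArg (fun η => η v) (ih (ω.curryLeft x))
    have h2 : X.act ⁅y, z⁆ x = X.act y (X.act z x) - X.act z (X.act y x) := by
      rw [LieHom.map_lie, LieDerivation.lie_apply]
    have h3 : ω (Matrix.vecCons (X.act ⁅y, z⁆ x) v) =
        ω (Matrix.vecCons (X.act y (X.act z x)) v) -
          ω (Matrix.vecCons (X.act z (X.act y x)) v) := by
      change ω.curryLeft _ v = ω.curryLeft _ v - ω.curryLeft _ v
      rw [h2, map_sub]; rfl
    simp only [AlternatingMap.sub_apply, hochRep_vecCons, hochRep_curryLeft, map_sub, h3] at h1 ⊢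
    rw [h1]
    abel

theorem coefRep_lie (r : ℕ) (y z : h) (ω : Coef K g W V r) :
    coefRep ρ r ⁅y, z⁆ ω = coefRep ρ r y (coefRep ρ r z ω) - coefRep ρ r z (coefRep ρ r y ω) := by
  cases r with
  | zero => exact ρ.onV_lie y z ω
  | succ r => exact hochRep_lie ρ (r + 1) y z ω

/-- Insertion of an element of `g` in the first slot, in positive degrees. -/
def contractSucc (φ : W →ₗ[K] V) (r : ℕ) (x : g) : Coef K g W V (r + 1) →ₗ[K] Coef K g W V r :=
  contract φ (r + 1) x

/-- In degree one the contraction lands in `V`, and the formula holds because `φ` intertwines the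
actions on `W` and `V`. In higher degrees it is the Leibniz rule for `hochRep`. -/
theorem coefRep_contractSucc (r : ℕ) (y : h) (x : g) (ω : Coef K g W V (r + 1)) :
    coefRep ρ r y (contractSucc φ r x ω) - contractSucc φ r x (coefRep ρ (r + 1) y ω) =
      contractSucc φ r (X.act y x) ω := by
  match r with
  | 0 =>
    have key : ∀ η : g [⋀^Fin 1]→ₗ[K] W, ρ.onV y (φ (η fun _ => x)) -
        φ (hochRep ρ 1 y η fun _ => x) = φ (η fun _ => X.act y x) := by
      intro η
      rw [hochRep_apply]
      simp only [Finset.univ_unique, Finset.sum_singleton, map_sub, ρ.map_onW, sub_sub_cancel,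
        Function.update_eq_const_of_subsingleton]
      rfl
    exact key ω
  | r + 1 =>
    have key : ∀ η : g [⋀^Fin (r + 2)]→ₗ[K] W, hochRep ρ (r + 1) y (η.curryLeft x) -
        (hochRep ρ (r + 2) y η).curryLeft x = η.curryLeft (X.act y x) := by
      intro η
      rw [hochRep_curryLeft, sub_sub_cancel]
    exact key ω

theorem contractSucc_coefDiff_zero (x : g) (v : Coef K g W V 0) :
    contractSucc φ 0 x (coefDiff ρ 0 v) = coefRep ρ 0 (X.mu x) v := (ρ.onV_mu x v).symm

/-- The Peiffer identity turns the brackets `[x, v_k]` in Cartan's formula into the action of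
`μ(x)`. For `r = 0` the contracted form still takes its value in `W`; the passage to `V` is made in
`contractSucc_coefDiff`. -/
theorem ceDiff_vecCons (r : ℕ) (x : g) (η : g [⋀^Fin (r + 1)]→ₗ[K] W) (v : Fin (r + 1) → g) :
    ceDiff (ρ.onW ∘ₗ (X.mu : g →ₗ[K] h)) (r + 1) η (Matrix.vecCons x v) +
      ceDiff (ρ.onW ∘ₗ (X.mu : g →ₗ[K] h)) r (η.curryLeft x) v =
        hochRep ρ (r + 1) (X.mu x) η v := by
  rw [ceDiff_curryLeft, hochRep_apply, sub_add_cancel]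
  simp only [X.peiffer]
  rfl

/-- Cartan's formula for the coefficients. -/
theorem contractSucc_coefDiff (r : ℕ) (x : g) (ω : Coef K g W V (r + 1)) :
    contractSucc φ (r + 1) x (coefDiff ρ (r + 1) ω) + coefDiff ρ r (contractSucc φ r x ω) =
      coefRep ρ (r + 1) (X.mu x) ω := by
  match r with
  | 0 =>
    -- The contraction `η(x) ∈ W` goes to `V` by `φ` and back by `ρ₁`. Since `ρ₁(z) φ = ρ₀¹(μ z)`,
    -- the result is the Chevalley-Eilenberg differential of the element `η(x)` of `W`.
    have key : ∀ η : g [⋀^Fin 1]→ₗ[K] W,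
        (ceDiff (ρ.onW ∘ₗ (X.mu : g →ₗ[K] h)) 1 η).curryLeft x + arrowDiff ρ (φ (η fun _ => x)) =
          hochRep ρ 1 (X.mu x) η := by
      intro η
      ext v
      rw [← ceDiff_vecCons, AlternatingMap.add_apply, arrowDiff_apply, ceDiff_apply_zero,
        AlternatingMap.curryLeft_apply_apply, AlternatingMap.curryLeft_apply_apply,
        LinearMap.comp_apply, LieHom.coe_toLinearMap, ρ.onW_mu]
      congr 4
      ext i
      rw [Subsingleton.elim i 0]
      rfl
    exact key ω
  | r + 1 => exact AlternatingMap.ext fun v => ceDiff_vecCons ρ (r + 1) x ω v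

/-- The degree starts at two because in degree one the contraction involves `φ`, which need not be
injective; identities in degree one need a direct check. -/
theorem coef_ext {r : ℕ} {ω η : Coef K g W V (r + 2)}
    (h : ∀ x, contractSucc φ (r + 1) x ω = contractSucc φ (r + 1) x η) : ω = η := by
  have key : ∀ α β : g [⋀^Fin (r + 2)]→ₗ[K] W, (∀ x, α.curryLeft x = β.curryLeft x) → α = β :=
    fun α β h => ext_vecCons fun x v => congrArg (fun γ => γ v) (h x)
  exact key ω η h

/-- In degree `0` this is the compatibility of `ρ₁` with the actions. Above it, contraction with `x`
and Cartan's formula reduce the claim to the case of `ι_x ω` and to `[L_y, L_{μ x}] = L_{μ(𝓛_y x)}`,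
which is equivariance of `μ`. -/
theorem coefRep_coefDiff (r : ℕ) (y : h) (ω : Coef K g W V r) :
    coefRep ρ (r + 1) y (coefDiff ρ r ω) = coefDiff ρ r (coefRep ρ r y ω) := by
  induction r with
  | zero =>
    have key : ∀ v : V, hochRep ρ 1 y (arrowDiff ρ v) = arrowDiff ρ (ρ.onV y v) := by
      intro v
      ext x
      rw [hochRep_apply]
      simp [arrowDiff_apply, ρ.arrow_act]
    exact key ω
  | succ r ih =>
    refine coef_ext (φ := φ) fun x => ?_
    have e1 := coefRep_contractSucc ρ (r + 1) y x (coefDiff ρ (r + 1) ω)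
    have e2 := congrArg (coefRep ρ (r + 1) y) (contractSucc_coefDiff ρ r x ω)
    have e3 := contractSucc_coefDiff ρ r x (coefRep ρ (r + 1) y ω)
    have e4 := contractSucc_coefDiff ρ r (X.act y x) ω
    have e5 := ih (contractSucc φ r x ω)
    have e6 := congrArg (coefDiff ρ r) (coefRep_contractSucc ρ r y x ω)
    have e7 := coefRep_lie ρ (r + 1) y (X.mu x) ω
    rw [X.equivariance] at e4
    rw [map_add] at e2
    rw [map_sub] at e6
    linear_combination (norm := abel) -e1 + e2 - e3 - e4 - e5 - e6 - e7

/-- Cartan's formula gives `ι_x d² = [L_{μ x}, d] + d² ι_x`. The commutator vanishes, and the last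
term is absent in degree `0` and covered by induction above it. -/
theorem coefDiff_coefDiff (r : ℕ) (ω : Coef K g W V r) :
    coefDiff ρ (r + 1) (coefDiff ρ r ω) = 0 := by
  induction r with
  | zero =>
    refine coef_ext (φ := φ) fun x => ?_
    have e1 := contractSucc_coefDiff ρ 0 x (coefDiff ρ 0 ω)
    rwa [coefRep_coefDiff, contractSucc_coefDiff_zero, add_eq_right,
      ← map_zero (contractSucc φ 1 x)]
      at e1
  | succ r ih =>
    refine coef_ext (φ := φ) fun x => ?_
    have e1 := contractSucc_coefDiff ρ (r + 1) x (coefDiff ρ (r + 1) ω)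
    have e2 := congrArg (coefDiff ρ (r + 1)) (contractSucc_coefDiff ρ r x ω)
    have e3 := ih (contractSucc φ r x ω)
    rw [map_add, e3, add_zero] at e2
    rwa [coefRep_coefDiff, e2, add_eq_right, ← map_zero (contractSucc φ (r + 2) x)] at e1

/-- Polarisation of `contract_contract`. -/
theorem contractSucc_anticomm (r : ℕ) (x y : g) (ω : Coef K g W V (r + 2)) :
    contractSucc φ r x (contractSucc φ (r + 1) y ω) =
      - contractSucc φ r y (contractSucc φ (r + 1) x ω) := by
  have hadd : ∀ (s : ℕ) (a b : g), contractSucc (V := V) φ s (a + b) =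
      contractSucc φ s a + contractSucc φ s b := fun s a b => map_add (contract φ (s + 1)) a b
  have h0 : ∀ z, contractSucc φ r z (contractSucc φ (r + 1) z ω) = 0 := fun z =>
    contract_contract φ (r + 2) z ω
  have h1 := h0 (x + y)
  rw [hadd, hadd, LinearMap.add_apply, LinearMap.add_apply, map_add, map_add, h0, h0, zero_add,
    add_zero] at h1
  exact eq_neg_of_add_eq_zero_left h1

end Coefficients

/-! ### The coefficients of all degrees together -/

section Total

variable {X : CrossedModule K g h} {φ : W →ₗ[K] V} (ρ : TwoRep X φ)

/-- The sum of the coefficients of all degrees. -/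
abbrev TotCoef (K : Type*) [Field K] (g W V : Type u) [LieRing g] [LieAlgebra K g]
    [AddCommGroup W] [Module K W] [AddCommGroup V] [Module K V] : Type u :=
  ⨁ r : ℕ, Coef K g W V r

/-- The inclusion of the coefficients of degree `r`. -/
def ofCoef (r : ℕ) : Coef K g W V r →ₗ[K] TotCoef K g W V :=
  DirectSum.lof K ℕ (fun r => Coef K g W V r) r

/-- Insertion of an element of `g`, in all degrees. -/
def totContract (φ : W →ₗ[K] V) : g →ₗ[K] Module.End K (TotCoef K g W V) where
  toFun x := DirectSum.toModule K ℕ _ fun r => ofCoef (r - 1) ∘ₗ contract φ r x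
  map_add' x y := DirectSum.linearMap_ext K fun r => LinearMap.ext fun ω => by
    simp [DirectSum.toModule_lof]
  map_smul' t x := DirectSum.linearMap_ext K fun r => LinearMap.ext fun ω => by
    simp [DirectSum.toModule_lof]

/-- The representation of `h` on the coefficients of all degrees. -/
def totRep : h →ₗ[K] Module.End K (TotCoef K g W V) where
  toFun y := DirectSum.toModule K ℕ _ fun r => ofCoef r ∘ₗ coefRep ρ r y
  map_add' x y := DirectSum.linearMap_ext K fun r => LinearMap.ext fun ω => by
    simp [DirectSum.toModule_lof]
  map_smul' t x := DirectSum.linearMap_ext K fun r => LinearMap.ext fun ω => by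
    simp [DirectSum.toModule_lof]

/-- The differential of the coefficients of all degrees. -/
def totDiff : Module.End K (TotCoef K g W V) :=
  DirectSum.toModule K ℕ _ fun r => ofCoef (r + 1) ∘ₗ coefDiff ρ r

theorem totContract_ofCoef (r : ℕ) (x : g) (ω : Coef K g W V r) :
    totContract φ x (ofCoef r ω) = ofCoef (r - 1) (contract φ r x ω) :=
  DirectSum.toModule_lof ..

theorem totContract_ofCoef_zero (x : g) (ω : Coef K g W V 0) :
    totContract φ x (ofCoef 0 ω) = 0 :=
  (totContract_ofCoef 0 x ω).trans (map_zero _)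

theorem totContract_ofCoef_succ (r : ℕ) (x : g) (ω : Coef K g W V (r + 1)) :
    totContract φ x (ofCoef (r + 1) ω) = ofCoef r (contractSucc φ r x ω) :=
  totContract_ofCoef ..

theorem totRep_ofCoef (r : ℕ) (y : h) (ω : Coef K g W V r) :
    totRep ρ y (ofCoef r ω) = ofCoef r (coefRep ρ r y ω) :=
  DirectSum.toModule_lof ..

theorem totDiff_ofCoef (r : ℕ) (ω : Coef K g W V r) :
    totDiff ρ (ofCoef r ω) = ofCoef (r + 1) (coefDiff ρ r ω) :=
  DirectSum.toModule_lof ..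

@[elab_as_elim]
theorem TotCoef.induction {p : TotCoef K g W V → Prop} (hp : ∀ r ω, p (ofCoef r ω))
    (hadd : ∀ a b, p a → p b → p (a + b)) (h0 : p 0) (n : TotCoef K g W V) : p n :=
  DirectSum.induction_on n h0 (fun r ω => hp r ω) hadd

theorem totContract_anticomm (x y : g) (n : TotCoef K g W V) :
    totContract φ x (totContract φ y n) = - totContract φ y (totContract φ x n) := by
  refine TotCoef.induction (fun r ω => ?_) (fun a b ha hb => ?_) ?_ n
  · match r with
    | 0 => simp only [totContract_ofCoef_zero, map_zero, neg_zero]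
    | 1 => simp only [totContract_ofCoef_succ, totContract_ofCoef_zero, neg_zero]
    | r + 2 => simp only [totContract_ofCoef_succ, contractSucc_anticomm r x y, map_neg]
  · simp only [map_add, ha, hb]; abel
  · simp

theorem totRep_lie (y z : h) (n : TotCoef K g W V) :
    totRep ρ ⁅y, z⁆ n = totRep ρ y (totRep ρ z n) - totRep ρ z (totRep ρ y n) := by
  refine TotCoef.induction (fun r ω => ?_) (fun a b ha hb => ?_) ?_ n
  · simp only [totRep_ofCoef, coefRep_lie, map_sub]
  · simp only [map_add, ha, hb]; abel
  · simp

theorem totRep_totContract (y : h) (x : g) (n : TotCoef K g W V) :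
    totRep ρ y (totContract φ x n) - totContract φ x (totRep ρ y n) =
      totContract φ (X.act y x) n := by
  refine TotCoef.induction (fun r ω => ?_) (fun a b ha hb => ?_) ?_ n
  · match r with
    | 0 => simp only [totRep_ofCoef, totContract_ofCoef_zero, map_zero, sub_zero]
    | r + 1 =>
      simp only [totRep_ofCoef, totContract_ofCoef_succ, ← map_sub, coefRep_contractSucc]
  · simp only [map_add, ← ha, ← hb]; abel
  · simp

theorem totRep_totDiff (y : h) (n : TotCoef K g W V) :
    totRep ρ y (totDiff ρ n) = totDiff ρ (totRep ρ y n) := by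
  refine TotCoef.induction (fun r ω => ?_) (fun a b ha hb => ?_) ?_ n
  · simp only [totRep_ofCoef, totDiff_ofCoef, coefRep_coefDiff]
  · simp only [map_add, ha, hb]
  · simp

theorem totDiff_totDiff (n : TotCoef K g W V) : totDiff ρ (totDiff ρ n) = 0 := by
  refine TotCoef.induction (fun r ω => ?_) (fun a b ha hb => ?_) ?_ n
  · simp only [totDiff_ofCoef, coefDiff_coefDiff, map_zero]
  · simp only [map_add, ha, hb, add_zero]
  · simp

theorem totContract_totDiff (x : g) (n : TotCoef K g W V) :
    totContract φ x (totDiff ρ n) + totDiff ρ (totContract φ x n) = totRep ρ (X.mu x) n := by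
  refine TotCoef.induction (fun r ω => ?_) (fun a b ha hb => ?_) ?_ n
  · cases r with
    | zero => simp only [totRep_ofCoef, totDiff_ofCoef, totContract_ofCoef_succ,
        totContract_ofCoef_zero, contractSucc_coefDiff_zero, map_zero, add_zero]
    | succ r => simp only [totRep_ofCoef, totDiff_ofCoef, totContract_ofCoef_succ, ← map_add,
        contractSucc_coefDiff]
  · simp only [map_add, ← ha, ← hb]; abel
  · simp

/-- Both sides contract with the first vector first. Since `insertMul` adds its last argument
outermost, the list is split at its end. -/
theorem foldl_totContract (r k : ℕ) (x : Fin k → g) (ω : Coef K g W V r) :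
    (List.ofFn x).foldl (fun n y => totContract φ y n) (ofCoef r ω) =
      ofCoef (r - k) (insertAlt φ r k x ω) := by
  change _ = ofCoef (r - k) (insertMul φ r k x ω)
  induction k with
  | zero => rw [List.ofFn_zero]; rfl
  | succ k ih =>
    have := ih (Fin.init x)
    rw [List.ofFn_succ', List.concat_eq_append, List.foldl_append, insertMul_succ]
    change totContract φ _ ((List.ofFn (Fin.init x)).foldl _ _) = _
    rw [this, totContract_ofCoef]
    rfl

end Total

end

section

open ListCochain

/-! ### Faces, vertices and brackets of the nerve -/

section NerveFaces

variable {K : Type*} [Field K] {g h : Type*} [LieRing g] [LieAlgebra K g]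
  [LieRing h] [LieAlgebra K h] (X : CrossedModule K g h)

theorem Nerve.vertex_step_apply {p : ℕ} (i : Fin p) (ξ : Nerve X p) :
    Nerve.vertex X (i : ℕ) ξ = Nerve.vertex X ((i : ℕ) + 1) ξ + X.mu (Nerve.coord X i ξ) := by
  rw [Nerve.vertex_step]; rfl

/-- The face `∂_k` deletes the vertex `v_k` of the string. The induction descends from the last
vertex, which is the base coordinate. -/
theorem Nerve.vertex_face {p : ℕ} (k : Fin (p + 2)) (ξ : Nerve X (p + 1)) (j : ℕ) (hj : j ≤ p) :
    Nerve.vertex X j (Nerve.face X k ξ) =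
      if j < k then Nerve.vertex X j ξ else Nerve.vertex X (j + 1) ξ := by
  rcases hj.lt_or_eq with hlt | rfl
  · have ih := Nerve.vertex_face k ξ (j + 1) hlt
    have h1 := Nerve.vertex_step_apply X (⟨j, hlt⟩ : Fin p) (Nerve.face X k ξ)
    have h2 := Nerve.vertex_step_apply X (⟨j, by omega⟩ : Fin (p + 1)) ξ
    have h3 := Nerve.vertex_step_apply X (⟨j + 1, by omega⟩ : Fin (p + 1)) ξ
    simp only at h1 h2 h3
    rw [h1, ih, Nerve.coord_face]
    simp only [Fin.castSucc_mk, Fin.succ_mk]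
    split_ifs <;> first | omega | simp only [h2, h3, map_add] <;> abel
  · have h2 := Nerve.vertex_step_apply X (Fin.last j) ξ
    rw [Fin.val_last, Nerve.vertex_of_le X le_rfl] at h2
    have := k.2
    rw [Nerve.vertex_of_le X le_rfl, Nerve.vertex_of_le X le_rfl, Nerve.base_face, h2]
    split_ifs <;> first | omega | rfl
termination_by p - j

/-- Only the merged coordinate `x^{k-1} + x^k` needs work: `v_k = v_{k+1} + μ(x^k)` and the Peiffer
identity produce its cross brackets. The base of a face is a vertex of the string, and vertices
respect brackets. -/
theorem Nerve.face_lie {p : ℕ} (k : Fin (p + 2)) (ξ η : Nerve X (p + 1)) :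
    Nerve.face X k ⁅ξ, η⁆ = ⁅Nerve.face X k ξ, Nerve.face X k η⁆ := by
  refine Nerve.ext' X (fun i => ?_) ?_
  · have h3 := fun ξ => Nerve.vertex_step_apply X i.succ ξ
    simp only [Fin.val_succ] at h3
    have hi := i.2
    rw [Nerve.coord_lie, Nerve.vertex_face X k ξ _ (by omega), Nerve.vertex_face X k η _ (by omega),
      Nerve.coord_face, Nerve.coord_face, Nerve.coord_face]
    split_ifs with h1 h2
    · exact Nerve.coord_lie X i.castSucc ξ η
    · rw [Nerve.coord_lie, Nerve.coord_lie]
      simp only [Fin.val_castSucc, Fin.val_succ, h3, map_add, LieDerivation.add_apply, X.peiffer,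
        lie_add, add_lie]
      rw [← lie_skew (Nerve.coord X i.castSucc ξ) (Nerve.coord X i.succ η)]
      abel
    · exact Nerve.coord_lie X i.succ ξ η
  · have h2 := Nerve.vertex_face X k
    have h3 : ∀ ζ : Nerve X (p + 1), Nerve.base X (Nerve.face X k ζ) =
        if p < k then Nerve.vertex X p ζ else Nerve.vertex X (p + 1) ζ := fun ζ => by
      rw [← h2 ζ p le_rfl, Nerve.vertex_of_le X le_rfl]
    rw [Nerve.base_lie, h3, h3, h3]
    split_ifs <;> exact Nerve.vertex_lie X _ _ _

theorem Nerve.face_face {p : ℕ} {i j : Fin (p + 2)} (hij : i ≤ j) (ξ : Nerve X (p + 2)) :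
    Nerve.face X i (Nerve.face X j.succ ξ) = Nerve.face X j (Nerve.face X i.castSucc ξ) := by
  have hi := i.2
  have hj := j.2
  rw [Fin.le_def] at hij
  refine Nerve.ext' X (fun m => ?_) ?_
  · have hm := m.2
    have e : m.succ.castSucc = m.castSucc.succ := rfl
    simp only [Nerve.coord_face, Fin.val_castSucc, Fin.val_succ, e]
    split_ifs <;> first | omega | with_reducible rfl | abel
  · simp only [Nerve.base_face, Nerve.coord_face, Fin.val_castSucc, Fin.val_succ, Fin.val_last]
    have e : (Fin.last p).succ = Fin.last (p + 1) := rfl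
    split_ifs <;>
      first
      | omega
      | with_reducible rfl
      | (simp only [map_add, e]; done)
      | (simp only [map_add, e]; abel)

theorem Nerve.coord_zero_face_one {p : ℕ} (ξ : Nerve X (p + 2)) :
    Nerve.coord X 0 (Nerve.face X 1 ξ) = Nerve.coord X 0 ξ + Nerve.coord X 1 ξ := rfl

theorem Nerve.coord_zero_face_succ_succ {p : ℕ} (j : Fin (p + 1)) (ξ : Nerve X (p + 2)) :
    Nerve.coord X 0 (Nerve.face X j.succ.succ ξ) = Nerve.coord X 0 ξ := by
  rw [Nerve.coord_face, if_pos (by simp)]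
  rfl

end NerveFaces

variable {K : Type*} [Field K] {g h W V : Type u} [LieRing g] [LieAlgebra K g]
  [LieRing h] [LieAlgebra K h] [AddCommGroup W] [Module K W] [AddCommGroup V] [Module K V]
  {X : CrossedModule K g h} {φ : W →ₗ[K] V} (ρ : TwoRep X φ)

/-! ### The difference maps and the Chevalley-Eilenberg differentials -/

/-- The action of `g_p` on the coefficients through the `j`-th vertex. -/
def vertexRep (p j : ℕ) (ξ : Nerve X p) : Module.End K (TotCoef K g W V) :=
  totRep ρ (Nerve.vertex X j ξ)

/-- Insertion of the first coordinate of a string. -/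
def firstContract (X : CrossedModule K g h) (φ : W →ₗ[K] V) (p : ℕ) (ξ : Nerve X (p + 1)) :
    Module.End K (TotCoef K g W V) :=
  totContract φ (Nerve.coord X 0 ξ)

/-- The alternating sum of the pull-backs along all face maps but `∂_0`. -/
def upperFaces (X : CrossedModule K g h) (N : Type*) [AddCommGroup N] [Module K N] (p : ℕ) :
    (List (Nerve X p) → N) →ₗ[K] (List (Nerve X (p + 1)) → N) :=
  ∑ j : Fin (p + 1), (-1 : K) ^ ((j : ℕ) + 1) • pull K (Nerve.face X j.succ)

theorem upperFaces_apply {N : Type*} [AddCommGroup N] [Module K N] (p : ℕ)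
    (F : List (Nerve X p) → N) : upperFaces X N p F =
      ∑ j : Fin (p + 1), (-1 : K) ^ ((j : ℕ) + 1) • pull K (Nerve.face X j.succ) F := by
  rw [upperFaces, LinearMap.sum_apply]; rfl

/-- The difference maps on functions on lists. -/
def listΔ (X : CrossedModule K g h) (φ : W →ₗ[K] V) (p k : ℕ) :
    (List (Nerve X p) → TotCoef K g W V) →ₗ[K] (List (Nerve X (p + 1)) → TotCoef K g W V) :=
  diff (firstContract X φ p) k ∘ₗ pull K (Nerve.face X 0)
    + if k = 0 then upperFaces X (TotCoef K g W V) p else 0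

theorem listΔ_apply (p k : ℕ) (F : List (Nerve X p) → TotCoef K g W V) :
    listΔ X φ p k F = diff (firstContract X φ p) k (pull K (Nerve.face X 0) F)
      + if k = 0 then upperFaces X (TotCoef K g W V) p F else 0 := by
  rw [listΔ, LinearMap.add_apply]
  split_ifs <;> rfl

theorem vertexRep_lie (p j : ℕ) (ξ η : Nerve X p) (n : TotCoef K g W V) :
    vertexRep ρ p j ⁅ξ, η⁆ n =
      vertexRep ρ p j ξ (vertexRep ρ p j η n) - vertexRep ρ p j η (vertexRep ρ p j ξ n) := by
  rw [vertexRep, Nerve.vertex_lie, totRep_lie]; rfl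

theorem ce_coef_totDiff (p : ℕ) (F : List (Nerve X p) → TotCoef K g W V) :
    ce (vertexRep ρ p 0) (coef (totDiff ρ) F) = coef (totDiff ρ) (ce (vertexRep ρ p 0) F) := by
  have h0 : ∀ (F : List (Nerve X p) → TotCoef K g W V) l,
      diff (fun _ => (0 : Module.End K (TotCoef K g W V))) 1 F l = 0 := by
    intro F l
    induction l generalizing F with
    | nil => rfl
    | cons ξ l ih => rw [diff_one_cons, ih]; simp
  rw [ce_coef (w := fun _ => 0) fun ξ n => by
    rw [vertexRep, totRep_totDiff, sub_self]; rfl]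
  rw [show diff (fun _ => (0 : Module.End K (TotCoef K g W V))) 1 F = 0 from funext (h0 F),
    add_zero]

/-- An instance of `ce_diff_apply`: `ι_{x^0}` is a homotopy between the actions through `v_0` and
`v_1`, and `∂_0` sends `v_1` to the final target. Both commutators there equal the insertion of
`𝓛_{v_1(η)} x^0_ξ`, by the formula for the bracket of strings. -/
theorem ce_firstContract (p k : ℕ) (F : List (Nerve X p) → TotCoef K g W V) :
    ce (vertexRep ρ (p + 1) 0) (diff (firstContract X φ p) k (pull K (Nerve.face X 0) F))
      + (-1 : K) ^ (k + 1) • diff (firstContract X φ p) k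
          (pull K (Nerve.face X 0) (ce (vertexRep ρ p 0) F)) =
      coef (totDiff ρ) (diff (firstContract X φ p) (k + 1) (pull K (Nerve.face X 0) F))
      + (-1 : K) ^ k • diff (firstContract X φ p) (k + 1)
          (pull K (Nerve.face X 0) (coef (totDiff ρ) F)) := by
  have hv : ∀ ξ : Nerve X (p + 1), Nerve.vertex X 0 ξ =
      Nerve.vertex X 1 ξ + X.mu (Nerve.coord X 0 ξ) := fun ξ => Nerve.vertex_step_apply X 0 ξ
  have hp : pull K (Nerve.face X 0) (ce (vertexRep ρ p 0) F) =
      ce (vertexRep ρ (p + 1) 1) (pull K (Nerve.face X 0) F) := by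
    rw [← ce_pull (Nerve.face_lie X 0)]
    have : (fun ξ => vertexRep ρ p 0 (Nerve.face X 0 ξ)) = vertexRep ρ (p + 1) 1 := by
      ext1 ξ
      rw [vertexRep, Nerve.vertex_face X 0 ξ 0 (Nat.zero_le _), if_neg (by simp)]
      rfl
    rw [this]
  rw [hp, ← coef_pull]
  ext1 l
  refine ce_diff_apply (w := fun ξ η => totContract φ (X.act (Nerve.vertex X 1 η)
    (Nerve.coord X 0 ξ))) (fun ξ n => ?_) (fun ξ η n => ?_) (fun ξ η n => ?_)
    (fun ξ η ζ n => totContract_anticomm _ _ n) k _ l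
  · rw [totContract_totDiff, vertexRep, vertexRep, hv, map_add, LinearMap.add_apply,
      add_sub_cancel_left]
  · rw [vertexRep, totRep_totContract, Nerve.coord_lie, hv,
      ← LinearMap.sub_apply, ← map_sub, map_add, LieDerivation.add_apply, X.peiffer]
    congr 2
    simp only [Fin.val_zero, zero_add]
    abel
  · exact totRep_totContract ρ _ _ n

/-- The faces of positive index keep the final target `v_0` and respect brackets, so each pull-back
commutes with the differential. -/
theorem ce_upperFaces (p : ℕ) (F : List (Nerve X p) → TotCoef K g W V) :
    ce (vertexRep ρ (p + 1) 0) (upperFaces X (TotCoef K g W V) p F) =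
      upperFaces X (TotCoef K g W V) p (ce (vertexRep ρ p 0) F) := by
  rw [upperFaces_apply, upperFaces_apply, map_sum]
  refine Finset.sum_congr rfl fun j _ => ?_
  rw [map_smul, ← ce_pull (Nerve.face_lie X j.succ)]
  have : (fun ξ => vertexRep ρ p 0 (Nerve.face X j.succ ξ)) = vertexRep ρ (p + 1) 0 := by
    ext1 ξ
    rw [vertexRep, Nerve.vertex_face X _ ξ 0 (Nat.zero_le _), if_pos (by simp)]
    rfl
  rw [this]

theorem ce_listΔ (p k : ℕ) (F : List (Nerve X p) → TotCoef K g W V) :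
    ce (vertexRep ρ (p + 1) 0) (listΔ X φ p k F)
      + (-1 : K) ^ (k + 1) • listΔ X φ p k (ce (vertexRep ρ p 0) F) =
      coef (totDiff ρ) (listΔ X φ p (k + 1) F)
      + (-1 : K) ^ k • listΔ X φ p (k + 1) (coef (totDiff ρ) F) := by
  have h := ce_firstContract ρ p k F
  have h2 := ce_upperFaces ρ p F
  simp only [listΔ_apply, Nat.add_eq_zero_iff, one_ne_zero, and_false, if_false, add_zero, ← h]
  split_ifs with hk
  · subst hk
    rw [map_add, h2]
    module
  · simp only [add_zero]

theorem coef_listΔ_zero (p : ℕ) (F : List (Nerve X p) → TotCoef K g W V) :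
    coef (totDiff ρ) (listΔ X φ p 0 F) = listΔ X φ p 0 (coef (totDiff ρ) F) := by
  ext1 l
  simp only [listΔ_apply, diff_zero, if_true, upperFaces_apply, coef_apply, Pi.add_apply, map_add,
    Finset.sum_apply, map_sum, Pi.smul_apply, map_smul, pull_apply]

end

section

open ListCochain

variable {K : Type*} [Field K] {g h W V : Type u} [LieRing g] [LieAlgebra K g]
  [LieRing h] [LieAlgebra K h] [AddCommGroup W] [Module K W] [AddCommGroup V] [Module K V]
  {X : CrossedModule K g h} {φ : W →ₗ[K] V}

/-! ### Compositions of difference maps -/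

theorem pull_face_face {N : Type*} [AddCommGroup N] [Module K N] {p : ℕ} {i j : Fin (p + 2)}
    (hij : i ≤ j) (F : List (Nerve X p) → N) :
    pull K (Nerve.face X j.succ) (pull K (Nerve.face X i) F) =
      pull K (Nerve.face X i.castSucc) (pull K (Nerve.face X j) F) := by
  rw [pull_pull, pull_pull]
  congr 2
  ext1 ξ
  exact Nerve.face_face X hij ξ

theorem upperFaces_upperFaces {N : Type*} [AddCommGroup N] [Module K N] (p : ℕ)
    (F : List (Nerve X p) → N) : upperFaces X N (p + 1) (upperFaces X N p F) = 0 := by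
  simp only [upperFaces_apply, map_sum, Finset.smul_sum, map_smul, smul_smul]
  rw [Finset.sum_comm]
  refine (Fintype.sum_prod_type' fun (i : Fin (p + 2)) (j : Fin (p + 1)) =>
    ((-1 : K) ^ ((j : ℕ) + 1) * (-1) ^ ((i : ℕ) + 1)) •
      pull K (Nerve.face X i.succ) (pull K (Nerve.face X j.succ) F)).symm.trans ?_
  -- The faces of positive index are closed under the simplicial identities. In indices lowered by
  -- one, `(i, j)` with `i ≤ j` is paired with `(j + 1, i)`, and the signs are opposite.
  refine Finset.sum_involution (fun a _ =>
    if hle : (a.1 : ℕ) ≤ a.2 then (a.2.succ, a.1.castLT (by have := a.2.2; omega))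
    else (a.2.castSucc, a.1.pred fun h0 => hle (by rw [h0]; exact Nat.zero_le _)))
    ?_ ?_ (fun _ _ => Finset.mem_univ _) ?_
  · rintro ⟨i, j⟩ -
    by_cases hle : (i : ℕ) ≤ j
    · have hf := pull_face_face (X := X) (K := K) (i := (i.castLT (by have := j.2; omega)).succ)
        (j := j.succ) (Fin.le_def.2 (by simpa using hle)) F
      simp only [hle, dif_pos, hf, Fin.val_succ, Fin.val_castLT]
      rw [← Fin.succ_castSucc, Fin.castSucc_castLT]
      module
    · obtain ⟨i, rfl⟩ := Fin.exists_succ_eq.2 fun h0 : i = 0 =>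
        hle (by rw [h0]; exact Nat.zero_le _)
      rw [Fin.val_succ] at hle
      have hf := pull_face_face (X := X) (K := K) (i := j.succ) (j := i.succ)
        (Fin.le_def.2 (by simp only [Fin.val_succ]; omega)) F
      simp only [Fin.val_succ, hle, dif_neg, not_false_eq_true, hf, Fin.pred_succ, Fin.val_castSucc,
        Fin.succ_castSucc]
      module
  · rintro ⟨i, j⟩ - - heq
    have h1 := congrArg (fun a => (a.1 : ℕ)) heq
    dsimp only at h1
    split_ifs at h1 with hle
    · simp only [Fin.val_succ] at h1; omega
    · simp only [Fin.val_castSucc] at h1; omega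
  · rintro ⟨i, j⟩ -
    by_cases hle : (i : ℕ) ≤ j
    · simp only [hle, dif_pos, Fin.val_succ, Fin.val_castLT]
      rw [dif_neg (by omega)]
      simp
    · simp only [hle, dif_neg, not_false_eq_true, Fin.val_castSucc, Fin.val_pred]
      rw [dif_pos (by omega)]
      simp

/-- In the last term, `∂_1` has first coordinate `x^0 + x^1` and cancels the first term, by `∂_0 ∂_1
= ∂_0 ∂_0`. The face `∂_{j+2}` leaves `x^0` unchanged and cancels the face `∂_{j+1}` in the middle
term. -/
theorem diff_upperFaces (p k : ℕ) (F : List (Nerve X p) → TotCoef K g W V) :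
    diff (fun ξ => firstContract X φ (p + 1) ξ + totContract φ (Nerve.coord X 1 ξ)) k
        (pull K (Nerve.face X 0) (pull K (Nerve.face X 0) F))
      + diff (firstContract X φ (p + 1)) k (pull K (Nerve.face X 0) (upperFaces X _ p F))
      + upperFaces X _ (p + 1) (diff (firstContract X φ p) k (pull K (Nerve.face X 0) F)) = 0 := by
  rw [upperFaces_apply, upperFaces_apply, Fin.sum_univ_succ (n := p + 1), map_sum, map_sum,
    add_add_add_comm,
    ← Finset.sum_add_distrib, Finset.sum_eq_zero, add_zero]
  · rw [← diff_pull, pull_face_face (le_refl 0)]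
    have : (fun ξ => firstContract X φ p (Nerve.face X (Fin.succ 0) ξ)) =
        fun ξ => firstContract X φ (p + 1) ξ + totContract φ (Nerve.coord X 1 ξ) := by
      ext1 ξ
      exact (congrArg (totContract φ) (Nerve.coord_zero_face_one X ξ)).trans (map_add _ _ _)
    rw [this]
    simp
  · intro j _
    rw [map_smul, map_smul, ← diff_pull, pull_face_face (Fin.zero_le _)]
    have : (fun ξ => firstContract X φ p (Nerve.face X j.succ.succ ξ)) =
        firstContract X φ (p + 1) := by
      ext1 ξ
      exact congrArg (totContract φ) (Nerve.coord_zero_face_succ_succ X j ξ)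
    rw [this, Fin.castSucc_zero, Fin.val_succ]
    module

theorem sum_listΔ (p k : ℕ) (F : List (Nerve X p) → TotCoef K g W V) :
    ∑ i ∈ Finset.HasAntidiagonal.antidiagonal k, listΔ X φ (p + 1) i.1 (listΔ X φ p i.2 F) = 0 := by
  have key : ∀ i ∈ Finset.HasAntidiagonal.antidiagonal k,
      listΔ X φ (p + 1) i.1 (listΔ X φ p i.2 F) =
        diff (firstContract X φ (p + 1)) i.1 (diff (fun ξ => totContract φ (Nerve.coord X 1 ξ)) i.2
          (pull K (Nerve.face X 0) (pull K (Nerve.face X 0) F)))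
        + (if i.2 = 0 then diff (firstContract X φ (p + 1)) i.1
            (pull K (Nerve.face X 0) (upperFaces X _ p F)) else 0)
        + if i.1 = 0 then
            upperFaces X _ (p + 1) (diff (firstContract X φ p) i.2 (pull K (Nerve.face X 0) F))
              else 0 := by
    rintro ⟨a, b⟩ -
    simp only [listΔ_apply, map_add, ← diff_pull]
    have : (fun ξ => firstContract X φ p (Nerve.face X 0 ξ)) =
      fun ξ => totContract φ (Nerve.coord X 1 ξ) := rfl
    rw [this]
    by_cases ha : a = 0 <;> by_cases hb : b = 0 <;>
      simp only [ha, hb, if_true, if_false, map_zero, add_zero, upperFaces_upperFaces]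
    abel
  rw [Finset.sum_congr rfl key, Finset.sum_add_distrib, Finset.sum_add_distrib,
    sum_diff_diff (u := firstContract X φ (p + 1)) (fun ξ η n => totContract_anticomm _ _ n)]
  refine Eq.trans ?_ (diff_upperFaces (φ := φ) p k F)
  congr 1
  · congr 1
    -- Only `Δ_0` contains the upper faces, so each of the two mixed sums has a single term.
    rw [Finset.sum_eq_single (k, 0)]
    · simp
    · rintro ⟨a, b⟩ hab hne
      have := Finset.HasAntidiagonal.mem_antidiagonal.1 hab
      rw [if_neg]
      rintro rfl
      exact hne (by simp_all)
    · intro h; simp at h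
  · rw [Finset.sum_eq_single (0, k)]
    · simp
    · rintro ⟨a, b⟩ hab hne
      have := Finset.HasAntidiagonal.mem_antidiagonal.1 hab
      rw [if_neg]
      rintro rfl
      exact hne (by simp_all)
    · intro h; simp at h

end

section

open ListCochain

variable {K : Type*} [Field K] {g h W V : Type u} [LieRing g] [LieAlgebra K g]
  [LieRing h] [LieAlgebra K h] [AddCommGroup W] [Module K W] [AddCommGroup V] [Module K V]
  {X : CrossedModule K g h} {φ : W →ₗ[K] V} (ρ : TwoRep X φ)

/-! ### From cochains to functions on lists -/

section Bridge

variable (p q r : ℕ) (ω : Cochain X W V p q r)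

theorem toList_dQ : toList (ofCoef r) (q + 1) (dQ ρ p q r ω) =
    ce (vertexRep ρ p 0) (toList (ofCoef r) q ω) :=
  toList_ceDiff (L := Nerve X p) (ρ' := vertexRep ρ p 0) (fun _ m => (totRep_ofCoef ρ r _ m).symm)
    q ω

theorem toList_dR : toList (ofCoef (r + 1)) q (dR ρ p q r ω) =
    coef (totDiff ρ) (toList (ofCoef r) q ω) :=
  toList_compAlternatingMap (fun m => (totDiff_ofCoef ρ r m).symm) q ω

theorem toList_dP : toList (ofCoef r) q (dP X W V p q r ω) =
    listΔ X φ p 0 (toList (ofCoef r) q ω) := by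
  rw [dP, LinearMap.sum_apply, map_sum, listΔ_apply, if_pos rfl, upperFaces_apply,
    Fin.sum_univ_succ, diff_zero]
  simp only [LinearMap.smul_apply, map_smul, toList_pullback, Fin.val_zero, pow_zero, one_smul,
    Fin.val_succ]

theorem toList_shuffleDiff (k : ℕ) :
    toList (ofCoef (r - k)) (q + k) (shuffleDiff X φ p q r k ω) =
      diff (firstContract X φ p) k (pull K (Nerve.face X 0) (toList (ofCoef r) q ω)) := by
  refine eq_of_forall_ofFn (n := q + k) (fun l hl => toList_eq_zero _ hl) (fun l hl =>
    diff_eq_zero fun m hm => toList_eq_zero _ (by simp only [List.length_map]; omega)) fun v => ?_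
  rw [diff_eq_shuffleList]
  refine toList_shuffle_ofFn (ofCoef (r - k)) _ (fun x w => ?_) v
  rw [pull_apply, List.map_ofFn, toList_ofFn]
  have h1 := foldl_totContract (φ := φ) r k (fun m => Nerve.coord X 0 (x m))
    (ω fun m => Nerve.face X 0 (w m))
  have h2 : List.ofFn (fun m => Nerve.coord X 0 (x m)) = (List.ofFn x).map (Nerve.coord X 0) := by
    rw [List.map_ofFn]; rfl
  rw [h2, List.foldl_map] at h1
  exact h1

theorem toList_Δ (k : ℕ) : toList (ofCoef (r - k)) (q + k) (Δ X φ p q r k ω) =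
    listΔ X φ p k (toList (ofCoef r) q ω) := by
  cases k with
  | zero => exact toList_dP p q r ω
  | succ k =>
    rw [listΔ_apply, if_neg (Nat.succ_ne_zero k), add_zero]
    exact toList_shuffleDiff p q r ω (k + 1)

/-- The last of the `r + 1` insertions takes place in coefficient degree `r - r`, where contraction
is zero. -/
theorem Δ_eq_zero : Δ X φ p q r (r + 1) ω = 0 := by
  have h1 : ∀ n, n = 0 → ∀ x (η : Coef K g W V n), contract φ n x η = 0 := by
    rintro _ rfl _ _; rfl
  have h2 : ∀ x (η : Coef K g W V r), insertAlt φ r (r + 1) x η = 0 :=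
    fun x η => h1 (r - r) (Nat.sub_self r) _ _
  ext Ξ
  refine (shuffleDiff_apply p q r (r + 1) ω Ξ).trans (Finset.sum_eq_zero fun a _ => ?_)
  rw [h2, smul_zero]

/-- The direct sum of all spaces of cochains, as functions on lists. -/
def listMap (X : CrossedModule K g h) (W V : Type u) [AddCommGroup W] [Module K W]
    [AddCommGroup V] [Module K V] : (⨁ t : ℕ × ℕ × ℕ, Cochain X W V t.1 t.2.1 t.2.2) →ₗ[K]
      (∀ p, List (Nerve X p) → TotCoef K g W V) :=
  DirectSum.toModule K (ℕ × ℕ × ℕ) _ fun t =>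
    LinearMap.single K (fun p => List (Nerve X p) → TotCoef K g W V) t.1 ∘ₗ
      toList (ofCoef t.2.2) t.2.1

theorem listMap_incl : listMap X W V (incl ω) =
    LinearMap.single K (fun p => List (Nerve X p) → TotCoef K g W V) p
      (toList (ofCoef r) q ω) :=
  DirectSum.toModule_lof K (ι := ℕ × ℕ × ℕ) (M := fun t => Cochain X W V t.1 t.2.1 t.2.2)
    (p, q, r) ω

/-- All three degrees can be recovered: `p` from the factor, `q` from the length of the list and `r`
from the summand of the coefficients. This gives injectivity of `listMap`. -/
theorem component_listMap (v : Fin q → Nerve X p)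
    (z : ⨁ t : ℕ × ℕ × ℕ, Cochain X W V t.1 t.2.1 t.2.2) :
    DirectSum.component K ℕ (fun r => Coef K g W V r) r (listMap X W V z p (List.ofFn v)) =
      DirectSum.component K (ℕ × ℕ × ℕ) (fun t => Cochain X W V t.1 t.2.1 t.2.2) (p, q, r) z v := by
  refine DirectSum.induction_on z (by simp) ?_ fun a b ha hb => ?_
  · rintro ⟨p', q', r'⟩ ω
    have h1 : listMap X W V (DirectSum.of _ (p', q', r') ω) =
      Pi.single p' (toList (ofCoef r') q' ω) := listMap_incl p' q' r' ω
    rw [h1]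
    by_cases hp : p = p'
    · subst hp
      by_cases hq : q = q'
      · subst hq
        rw [Pi.single_eq_same, toList_ofFn]
        by_cases hr : r = r'
        · subst hr
          have e2 : DirectSum.component K (ℕ × ℕ × ℕ) (fun t => Cochain X W V t.1 t.2.1 t.2.2)
              (p, q, r) (DirectSum.of _ (p, q, r) ω) = ω :=
            DirectSum.of_eq_same (β := fun t : ℕ × ℕ × ℕ => Cochain X W V t.1 t.2.1 t.2.2) (p, q, r)
              ω
          rw [e2]
          exact DirectSum.component.lof_self K r (ω v)
        · have e1 : DirectSum.component K ℕ (fun r => Coef K g W V r) r (ofCoef r' (ω v)) = 0 :=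
            DirectSum.of_eq_of_ne _ _ _ hr
          have e2 : DirectSum.component K (ℕ × ℕ × ℕ) (fun t => Cochain X W V t.1 t.2.1 t.2.2)
              (p, q, r) (DirectSum.of _ (p, q, r') ω) = 0 :=
            DirectSum.of_eq_of_ne _ _ _ (by simp [hr])
          rw [e1, e2]; rfl
      · have e2 : DirectSum.component K (ℕ × ℕ × ℕ) (fun t => Cochain X W V t.1 t.2.1 t.2.2)
            (p, q, r) (DirectSum.of _ (p, q', r') ω) = 0 :=
          DirectSum.of_eq_of_ne _ _ _ (by simp [hq])
        rw [e2, Pi.single_eq_same, toList_eq_zero _ (by simpa using hq), map_zero]; rfl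
    · have e2 : DirectSum.component K (ℕ × ℕ × ℕ) (fun t => Cochain X W V t.1 t.2.1 t.2.2)
          (p, q, r) (DirectSum.of _ (p', q', r') ω) = 0 :=
        DirectSum.of_eq_of_ne _ _ _ (by simp [hp])
      rw [e2, Pi.single_eq_of_ne hp]
      exact map_zero _
  · rw [map_add, map_add, AlternatingMap.add_apply, Pi.add_apply, Pi.add_apply, map_add, ha, hb]

theorem listMap_injective : Function.Injective (listMap X W V) := by
  intro z z' hz
  refine DirectSum.ext_component K fun t => AlternatingMap.ext fun v => ?_
  rw [← component_listMap t.1 t.2.1 t.2.2 v z, ← component_listMap t.1 t.2.1 t.2.2 v z', hz]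

end Bridge

/-! ### The structure equations for cochains -/

section Identities

variable (p q r : ℕ) (ω : Cochain X W V p q r)

theorem incl_dQ_Δ (k : ℕ) : incl (dQ ρ (p + 1) (q + k) (r - k) (Δ X φ p q r k ω))
      + (-1 : K) ^ (k + 1) • incl (Δ X φ p (q + 1) r k (dQ ρ p q r ω)) =
    incl (dR ρ (p + 1) (q + (k + 1)) (r - (k + 1)) (Δ X φ p q r (k + 1) ω))
      + (-1 : K) ^ k • incl (Δ X φ p q (r + 1) (k + 1) (dR ρ p q r ω)) := by
  apply listMap_injective
  have h := congrArg (LinearMap.single K (fun p => List (Nerve X p) → TotCoef K g W V) (p + 1))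
    (ce_listΔ ρ p k (toList (ofCoef r) q ω))
  simpa only [map_add, map_smul, listMap_incl, toList_dQ, toList_Δ, toList_dR] using h

theorem incl_dQ_dQ : incl (dQ ρ p (q + 1) r (dQ ρ p q r ω)) = 0 := by
  apply listMap_injective
  rw [listMap_incl, toList_dQ, toList_dQ, map_zero]
  refine (congrArg _ (funext fun l => ?_)).trans (map_zero _)
  exact ce_ce_apply (vertexRep_lie ρ p 0) (toList_additive _ ω) l

theorem incl_dR_dR : incl (dR ρ p q (r + 1) (dR ρ p q r ω)) = 0 := by
  apply listMap_injective
  rw [listMap_incl, toList_dR, toList_dR, map_zero]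
  exact (congrArg _ (funext fun l => totDiff_totDiff ρ _)).trans (map_zero _)

theorem incl_dQ_dR : incl (dQ ρ p q (r + 1) (dR ρ p q r ω)) =
    incl (dR ρ p (q + 1) r (dQ ρ p q r ω)) := by
  apply listMap_injective
  rw [listMap_incl, listMap_incl, toList_dQ, toList_dR, toList_dR, toList_dQ, ce_coef_totDiff]

theorem incl_dR_dP : incl (dR ρ (p + 1) q r (Δ X φ p q r 0 ω)) =
    incl (Δ X φ p q (r + 1) 0 (dR ρ p q r ω)) := by
  apply listMap_injective
  have h1 := toList_Δ (φ := φ) p q r ω 0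
  have h2 := toList_Δ (φ := φ) p q (r + 1) (dR ρ p q r ω) 0
  have h3 := toList_dR ρ (p + 1) q r (Δ X φ p q r 0 ω)
  rw [listMap_incl, listMap_incl]
  refine congrArg _ (h3.trans ?_)
  refine Eq.trans ?_ h2.symm
  rw [toList_dR, ← coef_listΔ_zero]
  exact congrArg _ h1

theorem sum_incl_Δ_Δ (k : ℕ) : ∑ i ∈ Finset.range (k + 1),
    incl (Δ X φ (p + 1) (q + i) (r - i) (k - i) (Δ X φ p q r i ω)) = 0 := by
  apply listMap_injective
  rw [map_sum, map_zero]
  simp only [listMap_incl, toList_Δ]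
  rw [← map_sum]
  refine (congrArg _ ?_).trans (map_zero _)
  rw [← sum_listΔ (φ := φ) p k, ← Finset.Nat.sum_antidiagonal_swap,
    Finset.Nat.sum_antidiagonal_eq_sum_range_succ_mk]
  rfl

end Identities

end

section

variable {K : Type*} [Field K] {g h W V : Type u} [LieRing g] [LieAlgebra K g]
  [LieRing h] [LieAlgebra K h] [AddCommGroup W] [Module K W] [AddCommGroup V] [Module K V]
  {X : CrossedModule K g h} {φ : W →ₗ[K] V} (ρ : TwoRep X φ)

/-! ### Signs of the total differential -/

section Signs

/-- The sign of `Δ_k` in the total differential on `C^{p,q}_r`. -/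
def deltaSign (K : Type*) [Field K] (q r k : ℕ) : K :=
  (-1) ^ (r + q * (k + 1) + k * (k - 1) / 2)

/-- This is the sign of `∂` in `∇`, so `∂` joins the sum of difference maps as the term `k = 0`. -/
theorem deltaSign_zero (q r : ℕ) : deltaSign K q r 0 = (-1) ^ (q + r) := by
  rw [deltaSign]; congr 1; omega

theorem deltaSign_succ_left (q r k : ℕ) :
    deltaSign K (q + 1) r k = (-1) ^ (k + 1) * deltaSign K q r k := by
  rw [deltaSign, deltaSign, ← pow_add]; congr 1; ring

theorem deltaSign_succ_mid (q r k : ℕ) : deltaSign K q (r + 1) k = - deltaSign K q r k := by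
  rw [deltaSign, deltaSign, add_right_comm r 1, add_right_comm _ 1, pow_succ]; ring

theorem deltaSign_succ_right (q r k : ℕ) :
    deltaSign K q r (k + 1) = (-1) ^ (q + k) * deltaSign K q r k := by
  rw [deltaSign, deltaSign, ← pow_add, Nat.triangle_succ]; congr 1; ring

/-- For fixed `q` the result depends only on `k + j`; hence all composites with a given sum of
indices have the same sign, and iii) applies to them. -/
theorem deltaSign_mul (q r k j : ℕ) (hk : k ≤ r) :
    deltaSign K q r k * deltaSign K (q + k) (r - k) j =
      (-1) ^ (q * (k + j) + (k + j) * (k + j - 1) / 2) := by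
  obtain ⟨s, rfl⟩ := Nat.exists_eq_add_of_le hk
  rw [Nat.add_sub_cancel_left]
  induction j with
  | zero =>
    rw [deltaSign_zero, deltaSign, ← pow_add]
    have : k + s + q * (k + 1) + k * (k - 1) / 2 + (q + k + s) =
        q * (k + 0) + (k + 0) * (k + 0 - 1) / 2 + 2 * (q + k + s) := by
      rw [add_zero]; ring
    rw [this, pow_add, pow_mul]
    simp
  | succ j ih =>
    rw [deltaSign_succ_right, mul_left_comm, ih, ← add_assoc, Nat.triangle_succ, ← pow_add]
    congr 1
    ring

end Signs

/-! ### The square of the total differential -/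

/-- The total differential on the sum of all spaces of cochains. -/
def nablaAll : (⨁ t : ℕ × ℕ × ℕ, Cochain X W V t.1 t.2.1 t.2.2) →ₗ[K]
    ⨁ t : ℕ × ℕ × ℕ, Cochain X W V t.1 t.2.1 t.2.2 :=
  DirectSum.toModule K (ℕ × ℕ × ℕ) _ fun t =>
    incl ∘ₗ dQ ρ t.1 t.2.1 t.2.2 + (-1 : K) ^ t.2.1 • (incl ∘ₗ dR ρ t.1 t.2.1 t.2.2)
      + ∑ k ∈ Finset.range (t.2.2 + 1), deltaSign K t.2.1 t.2.2 k •
          (incl ∘ₗ Δ X φ t.1 t.2.1 t.2.2 k)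

theorem nablaAll_incl {p q r : ℕ} (ω : Cochain X W V p q r) :
    nablaAll ρ (incl ω) = incl (dQ ρ p q r ω) + (-1 : K) ^ q • incl (dR ρ p q r ω)
      + ∑ k ∈ Finset.range (r + 1), deltaSign K q r k • incl (Δ X φ p q r k ω) := by
  refine (DirectSum.toModule_lof K (ι := ℕ × ℕ × ℕ)
    (M := fun t => Cochain X W V t.1 t.2.1 t.2.2) (p, q, r) ω).trans ?_
  simp only [LinearMap.add_apply, LinearMap.smul_apply, LinearMap.comp_apply, LinearMap.sum_apply]

theorem nablaAll_nablaAll_incl {p q r : ℕ} (ω : Cochain X W V p q r) :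
    nablaAll ρ (nablaAll ρ (incl ω)) = 0 := by
  -- Composites of two difference maps, regrouped by `m = k + j`.
  have hΔΔ : ∑ k ∈ Finset.range (r + 1), deltaSign K q r k •
      ∑ j ∈ Finset.range (r - k + 1), deltaSign K (q + k) (r - k) j •
        incl (Δ X φ (p + 1) (q + k) (r - k) j (Δ X φ p q r k ω)) = 0 := by
    have h1 := Finset.sum_range_diag_flip (r + 1) fun k j =>
      (-1 : K) ^ (q * (k + j) + (k + j) * (k + j - 1) / 2) •
        incl (Δ X φ (p + 1) (q + k) (r - k) j (Δ X φ p q r k ω))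
    rw [← Finset.sum_eq_zero (s := Finset.range (r + 1)) (f := fun m =>
      ∑ k ∈ Finset.range (m + 1), (-1 : K) ^ (q * (k + (m - k)) +
        (k + (m - k)) * (k + (m - k) - 1) / 2) •
        incl (Δ X φ (p + 1) (q + k) (r - k) (m - k) (Δ X φ p q r k ω))) fun m _ => ?_]
    · rw [h1]
      refine Finset.sum_congr rfl fun k hk => ?_
      have hk := Finset.mem_range.1 hk
      rw [Finset.smul_sum, show r + 1 - k = r - k + 1 by omega]
      refine Finset.sum_congr rfl fun j _ => ?_
      rw [smul_smul, deltaSign_mul q r k j (by omega)]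
    · rw [← smul_zero ((-1 : K) ^ (q * m + m * (m - 1) / 2)), ← sum_incl_Δ_Δ p q r ω m,
        Finset.smul_sum]
      refine Finset.sum_congr rfl fun k hk => ?_
      have hk := Finset.mem_range.1 hk
      rw [show k + (m - k) = m by omega]
  -- Identity i) multiplied by the sign of `Δ_k` and summed over `k`; it trades the terms with
  -- `δ^{(r)}` for terms with `δ_{(1)}`.
  have hQ : ∑ k ∈ Finset.range (r + 1), deltaSign K q r k •
        incl (dQ ρ (p + 1) (q + k) (r - k) (Δ X φ p q r k ω))
      + ∑ k ∈ Finset.range (r + 1),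
        deltaSign K (q + 1) r k • incl (Δ X φ p (q + 1) r k (dQ ρ p q r ω)) =
      ∑ k ∈ Finset.range (r + 1), (deltaSign K q r k •
        incl (dR ρ (p + 1) (q + (k + 1)) (r - (k + 1)) (Δ X φ p q r (k + 1) ω))
        + (deltaSign K q r k * (-1) ^ k) •
          incl (Δ X φ p q (r + 1) (k + 1) (dR ρ p q r ω))) := by
    rw [← Finset.sum_add_distrib]
    refine Finset.sum_congr rfl fun k _ => ?_
    have := incl_dQ_Δ ρ p q r ω k
    rw [deltaSign_succ_left, mul_comm, mul_smul, mul_smul, ← smul_add, this, smul_add]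
  -- The index is shifted by one: `Δ_{r+1} ω = 0` lets the sum be extended at the top, and the term
  -- of `∂` is split off at the bottom.
  have hR : ∑ k ∈ Finset.range (r + 1), (deltaSign K q r k * (-1) ^ (q + k)) •
        incl (dR ρ (p + 1) (q + k) (r - k) (Δ X φ p q r k ω)) =
      (-1 : K) ^ r • incl (dR ρ (p + 1) q r (Δ X φ p q r 0 ω)) -
      ∑ k ∈ Finset.range (r + 1), deltaSign K q r k •
        incl (dR ρ (p + 1) (q + (k + 1)) (r - (k + 1)) (Δ X φ p q r (k + 1) ω)) := by
    have h1 := Finset.sum_range_succ' (fun k => (deltaSign K q r k * (-1) ^ (q + k)) •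
      incl (dR ρ (p + 1) (q + k) (r - k) (Δ X φ p q r k ω))) (r + 1)
    rw [Finset.sum_range_succ, Δ_eq_zero, map_zero, map_zero, smul_zero, add_zero] at h1
    rw [h1, add_comm, sub_eq_add_neg, ← Finset.sum_neg_distrib]
    congr 1
    · have hs : deltaSign K q r 0 * (-1) ^ (q + 0) = (-1) ^ r := by
        rw [deltaSign_zero, add_zero, pow_add, mul_right_comm, ListCochain.neg_one_pow_sq, one_mul]
      rw [hs]
      rfl
    · refine Finset.sum_congr rfl fun k _ => ?_
      have hs : deltaSign K q r (k + 1) * (-1) ^ (q + (k + 1)) = - deltaSign K q r k := by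
        rw [deltaSign_succ_right, ← add_assoc, pow_succ, mul_right_comm, ← mul_assoc,
          ListCochain.neg_one_pow_sq, one_mul, neg_one_mul]
      refine (congrArg (fun s : K => s • incl (dR ρ (p + 1) (q + (k + 1)) (r - (k + 1))
        (Δ X φ p q r (k + 1) ω))) hs).trans ?_
      have hneg (c : K) (z : ⨁ t : ℕ × ℕ × ℕ, Cochain X W V t.1 t.2.1 t.2.2) :
          -c • z = -(c • z) := neg_smul c z
      exact hneg _ _
  -- The mirror image of `hR`. The terms of `∂` split off in the two cancel because `∂` commutes
  -- with `δ_{(1)}`.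
  have hD : (-1 : K) ^ q • ∑ k ∈ Finset.range (r + 1 + 1), deltaSign K q (r + 1) k •
        incl (Δ X φ p q (r + 1) k (dR ρ p q r ω)) =
      - ((-1 : K) ^ r • incl (dR ρ (p + 1) q r (Δ X φ p q r 0 ω))) -
      ∑ k ∈ Finset.range (r + 1), (deltaSign K q r k * (-1) ^ k) •
          incl (Δ X φ p q (r + 1) (k + 1) (dR ρ p q r ω)) := by
    rw [Finset.sum_range_succ', smul_add, add_comm, sub_eq_add_neg, ← Finset.sum_neg_distrib,
      Finset.smul_sum]
    congr 1
    · have h0 : incl (Δ X φ p q (r + 1) 0 (dR ρ p q r ω)) =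
          incl (dR ρ (p + 1) q r (Δ X φ p q r 0 ω)) := (incl_dR_dP ρ p q r ω).symm
      refine (congrArg (fun z => (-1 : K) ^ q • deltaSign K q (r + 1) 0 • z) h0).trans ?_
      rw [deltaSign_succ_mid, deltaSign_zero, smul_smul, mul_neg, pow_add, ← mul_assoc,
        ListCochain.neg_one_pow_sq, one_mul, neg_smul]
    · refine Finset.sum_congr rfl fun k _ => ?_
      rw [deltaSign_succ_mid, deltaSign_succ_right, smul_smul, mul_neg, pow_add, ← mul_assoc,
        ← mul_assoc, ListCochain.neg_one_pow_sq, one_mul, neg_smul, mul_comm]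
  have hrest : ∑ k ∈ Finset.range (r + 1), deltaSign K q r k • nablaAll ρ (incl (Δ X φ p q r k ω)) =
      ∑ k ∈ Finset.range (r + 1), deltaSign K q r k •
        incl (dQ ρ (p + 1) (q + k) (r - k) (Δ X φ p q r k ω)) +
      ∑ k ∈ Finset.range (r + 1), (deltaSign K q r k * (-1) ^ (q + k)) •
        incl (dR ρ (p + 1) (q + k) (r - k) (Δ X φ p q r k ω)) := by
    refine Eq.trans ?_ (add_zero _)
    rw [← hΔΔ, ← Finset.sum_add_distrib, ← Finset.sum_add_distrib]
    refine Finset.sum_congr rfl fun k _ => ?_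
    rw [nablaAll_incl, smul_add, smul_add, mul_smul]
  rw [nablaAll_incl, map_add, map_add, map_smul, map_sum]
  simp only [map_smul]
  rw [hrest, hR, nablaAll_incl, nablaAll_incl, incl_dQ_dQ, incl_dR_dR, incl_dQ_dR, smul_zero,
    add_zero, smul_add, hD, pow_succ]
  rw [Finset.sum_add_distrib] at hQ
  linear_combination (norm := module) hQ

/-- The inclusion of the cochains of total degree `n` in all cochains. -/
def totInclusion (X : CrossedModule K g h) (W V : Type u) [AddCommGroup W] [Module K W]
    [AddCommGroup V] [Module K V] (n : ℕ) : Ctot X W V n →ₗ[K]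
      ⨁ t : ℕ × ℕ × ℕ, Cochain X W V t.1 t.2.1 t.2.2 :=
  DirectSum.toModule K (Triple n) _ fun _ => incl

theorem totInclusion_inclTot {n p q r : ℕ} (hn : p + q + r = n) (ω : Cochain X W V p q r) :
    totInclusion X W V n (inclTot p q r hn ω) = incl ω :=
  DirectSum.toModule_lof K (ι := Triple n) (M := fun t => Cochain X W V t.1.1 t.1.2.1 t.1.2.2)
    ⟨(p, q, r), hn⟩ ω

theorem totInclusion_injective (n : ℕ) : Function.Injective (totInclusion X W V n) := by
  have key : ∀ (t : Triple n) (z : Ctot X W V n),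
      DirectSum.component K (ℕ × ℕ × ℕ) (fun t => Cochain X W V t.1 t.2.1 t.2.2) t.1
        (totInclusion X W V n z) =
      DirectSum.component K (Triple n) (fun t => Cochain X W V t.1.1 t.1.2.1 t.1.2.2) t z := by
    intro t z
    refine DirectSum.induction_on z (by simp) (fun t' ω => ?_) fun a b ha hb => by
      rw [map_add, map_add, map_add, ha, hb]
    have h1 : totInclusion X W V n (DirectSum.of _ t' ω) = DirectSum.of _ t'.1 ω :=
      totInclusion_inclTot t'.2 ω
    rw [h1]
    by_cases ht : t = t'
    · subst ht
      exact (DirectSum.of_eq_same (β := fun t : ℕ × ℕ × ℕ => Cochain X W V t.1 t.2.1 t.2.2)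
        t.1 ω).trans
        (DirectSum.of_eq_same (β := fun t : Triple n => Cochain X W V t.1.1 t.1.2.1 t.1.2.2)
          t ω).symm
    · exact (DirectSum.of_eq_of_ne (β := fun t : ℕ × ℕ × ℕ => Cochain X W V t.1 t.2.1 t.2.2) _ _ ω
          fun h => ht (Subtype.ext h)).trans
        (DirectSum.of_eq_of_ne (β := fun t : Triple n => Cochain X W V t.1.1 t.1.2.1 t.1.2.2)
          _ _ ω ht).symm
  intro z z' hz
  refine DirectSum.ext_component K fun t => ?_
  rw [← key, ← key, hz]

theorem totInclusion_nabla (n : ℕ) (z : Ctot X W V n) :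
    totInclusion X W V (n + 1) (nabla ρ n z) = nablaAll ρ (totInclusion X W V n z) := by
  refine DirectSum.induction_on z (by simp) (fun t ω => ?_) fun a b ha hb => by
    rw [map_add, map_add, map_add, map_add, ha, hb]
  obtain ⟨⟨p, q, r⟩, hn⟩ := t
  have h1 : nabla ρ n (DirectSum.of _ ⟨(p, q, r), hn⟩ ω) = nablaAt ρ n p q r hn ω :=
    DirectSum.toModule_lof K (ι := Triple n) (M := fun t => Cochain X W V t.1.1 t.1.2.1 t.1.2.2)
      ⟨(p, q, r), hn⟩ ω
  have h2 : totInclusion X W V n (DirectSum.of _ ⟨(p, q, r), hn⟩ ω) = incl ω :=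
    totInclusion_inclTot hn ω
  rw [h1, h2, nablaAll_incl, nablaAt]
  simp only [LinearMap.add_apply, LinearMap.smul_apply, LinearMap.comp_apply, LinearMap.sum_apply,
    map_add, map_smul, map_sum, totInclusion_inclTot]
  have h3 : Finset.range (r + 1) = insert 0 (Finset.Icc 1 r) := by
    ext k; simp only [Finset.mem_range, Finset.mem_insert, Finset.mem_Icc]; omega
  rw [h3, Finset.sum_insert (by simp), deltaSign_zero, ← add_assoc]
  congr 1
  exact Finset.sum_coe_sort (Finset.Icc 1 r) fun k =>
    deltaSign K q r k • incl (Δ X φ p q r k ω)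

theorem nabla_nabla (n : ℕ) : nabla ρ (n + 1) ∘ₗ nabla ρ n = 0 := by
  refine LinearMap.ext fun z => totInclusion_injective (n + 2) ?_
  rw [LinearMap.comp_apply, totInclusion_nabla, totInclusion_nabla, LinearMap.zero_apply, map_zero]
  refine DirectSum.induction_on (totInclusion X W V n z) (by simp) (fun t ω => ?_)
    fun a b ha hb => by rw [map_add, map_add, ha, hb, add_zero]
  exact nablaAll_nablaAll_incl ρ (p := t.1) (q := t.2.1) (r := t.2.2) ω

end

end LieTwo

end

/-! ### The main theorem -/

theorem mainTheorem2 {K : Type*} [Field K] {g h W V : Type u}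
    [LieRing g] [LieAlgebra K g] [LieRing h] [LieAlgebra K h]
    [AddCommGroup W] [Module K W] [AddCommGroup V] [Module K V]
    (X : LieTwo.CrossedModule K g h) (φ : W →ₗ[K] V) (ρ : LieTwo.TwoRep X φ) :
    -- `(C_tot, ∇)` is a complex
    (∀ n : ℕ, LieTwo.nabla ρ (n + 1) ∘ₗ LieTwo.nabla ρ n = 0) ∧
    -- i)
    (∀ (p q r k : ℕ), k < r → ∀ ω : LieTwo.Cochain X W V p q r,
      LieTwo.incl (LieTwo.dQ ρ (p + 1) (q + k) (r - k) (LieTwo.Δ X φ p q r k ω))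
          + (-1 : K) ^ (k + 1) •
            LieTwo.incl (LieTwo.Δ X φ p (q + 1) r k (LieTwo.dQ ρ p q r ω))
        = LieTwo.incl
            (LieTwo.dR ρ (p + 1) (q + (k + 1)) (r - (k + 1)) (LieTwo.Δ X φ p q r (k + 1) ω))
          + (-1 : K) ^ k •
            LieTwo.incl (LieTwo.Δ X φ p q (r + 1) (k + 1) (LieTwo.dR ρ p q r ω))) ∧
    -- ii)
    (∀ (p q r : ℕ) (ω : LieTwo.Cochain X W V p q r),
      LieTwo.incl (LieTwo.dQ ρ (p + 1) (q + r) (r - r) (LieTwo.Δ X φ p q r r ω))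
          + (-1 : K) ^ (r + 1) •
            LieTwo.incl (LieTwo.Δ X φ p (q + 1) r r (LieTwo.dQ ρ p q r ω))
        = (-1 : K) ^ r •
            LieTwo.incl (LieTwo.Δ X φ p q (r + 1) (r + 1) (LieTwo.dR ρ p q r ω))) ∧
    -- iii)
    (∀ (p q r k : ℕ), k ≤ r → ∀ ω : LieTwo.Cochain X W V p q r,
      ∑ i ∈ Finset.range (k + 1),
        LieTwo.incl (LieTwo.Δ X φ (p + 1) (q + i) (r - i) (k - i) (LieTwo.Δ X φ p q r i ω)) = 0) := by
  refine ⟨LieTwo.nabla_nabla ρ, fun p q r k _ ω => LieTwo.incl_dQ_Δ ρ p q r ω k, fun p q r ω => ?_,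
    fun p q r k _ ω => LieTwo.sum_incl_Δ_Δ p q r ω k⟩
  -- Identity ii) is i) at `k = r`, where `Δ_{r+1} ω` vanishes.
  rw [LieTwo.incl_dQ_Δ, LieTwo.Δ_eq_zero, map_zero, map_zero, zero_add]
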